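/- All Banach algebras are complex and need not be unital. For Banach spaces $E,F$ let $E\hat\otimes F$ be the projective tensor product, the completion of $E\otimes F$ in the norm $\|u\|_p=\inf\{\sum_i\|a_i\|\|b_i\| : u=\sum_i a_i\otimes b_i\}$. For a Banach algebra $A$, $A\hat\otimes A$ is the Banach $A$-bimodule with $a\cdot(b\otimes c)=ab\otimes c$ and $(b\otimes c)\cdot a=b\otimes ca$, and $\pi:A\hat\otimes A\to A$ is the bounded linear map with $\pi(a\otimes b)=ab$. A net $(u_\nu)$ in $A\hat\otimes A$ is an approximate diagonal for $A$ if $a\cdot u_\nu-u_\nu\cdot a\to0$ and $\pi(u_\nu)a\to a$ in norm for all $a\in A$; it is bounded if $\sup_\nu\|u_\nu\|_p<\infty$. $A$ is amenable if for every Banach $A$-bimodule $E$ every continuous derivation from $A$ into the dual bimodule $E^*$ is inner. Let $K_G$ be the complex Grothendieck constant: the least $k$ such that for all nonempty compact Hausdorff spaces $K_1,K_2$ and every bounded bilinear form $\Phi$ on $C(K_1)\times C(K_2)$ there are regular Borel probability measures $\mu_1,\mu_2$ on $K_1,K_2$ with $|\Phi(x,y)|\le k\|\Phi\|\left(\int|x|^2d\mu_1\int|y|^2d\mu_2\right)^{1/2}$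 for all $x,y$. Put $c=K_G/2$. Theorem. Let $X$ be a compact Hausdorff space and $A$ a Banach algebra, let $C(X,A)$ be the Banach algebra of continuous $A$-valued functions on $X$ with pointwise operations and the uniform norm, and let $C(X)=C(X,\mathbb C)$. For $t=\sum_i f_i\otimes g_i\in C(X)\otimes C(X)$ let $T(t,\cdot):A\hat\otimes A\to C(X,A)\hat\otimes C(X,A)$ be the bounded linear map with $T(t,a\otimes b)=\sum_i f_ia\otimes g_ib$. (i) If $(\alpha_\nu)$ is an approximate diagonal for $A$ with $\|\alpha_\nu\|_p\le M$ for all $\nu$, then $C(X,A)$ has a bounded approximate diagonal $(U_\gamma)$ with $\|U_\gamma\|_p\le 2cM$ for all $\gamma$, in which each $U_\gamma$ has the form $T(t,\alpha_\nu)$ for some $\nu$ and some $t=\sum_i f_i\otimes g_i\in C(X)\otimes C(X)$ with $\sum_i f_ig_i=1$ and $\|t\|_p\le 2c$. In particular, if $A$ has a bounded approximate diagonal, then so does $C(X,A)$; and if $A$ is amenable, then so is $C(X,A)$. (ii) Conversely, if $X$ is nonempty and $C(X,A)$ is amenable (respectively, has a bounded approximate diagonal), then so is (has) $A$. Hence,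 for nonempty $X$, $C(X,A)$ is amenable if and only if $A$ is amenable, and $C(X,A)$ has a bounded approximate diagonal if and only if $A$ has one. -/

import Mathlib

open scoped TensorProduct Topology NNReal ENNReal

universe u v w

namespace BanachAmenability

noncomputable section

/-! ### The Banach space projective tensor product -/

section ProjectiveTensor

variable (E : Type u) (F : Type v) [NormedAddCommGroup E] [NormedSpace ℂ E]
  [NormedAddCommGroup F] [NormedSpace ℂ F]

/-- The algebraic tensor product `E ⊗ F` (a type synonym, which carries the projective norm). -/
def AlgTensor : Type (max u v) := E ⊗[ℂ] F

instance : AddCommGroup (AlgTensor E F) := inferInstanceAs (AddCommGroup (E ⊗[ℂ] F))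

instance : Module ℂ (AlgTensor E F) := inferInstanceAs (Module ℂ (E ⊗[ℂ] F))

variable {E F}

/-- The costs `∑ ‖a i‖ * ‖b i‖` of the representations `t = ∑ a i ⊗ b i`. -/
def repCosts (t : E ⊗[ℂ] F) : Set ℝ :=
  {r | ∃ (n : ℕ) (a : Fin n → E) (b : Fin n → F),
    t = ∑ i, a i ⊗ₜ[ℂ] b i ∧ r = ∑ i, ‖a i‖ * ‖b i‖}

/-- The projective norm `‖t‖_p` on the algebraic tensor product. -/
def projNorm (t : E ⊗[ℂ] F) : ℝ := sInf (repCosts t)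

theorem repCosts_bddBelow (t : E ⊗[ℂ] F) : BddBelow (repCosts t) := by
  refine ⟨0, ?_⟩
  rintro r ⟨n, a, b, -, rfl⟩
  positivity

theorem repCosts_add {s t : E ⊗[ℂ] F} {p q : ℝ} (hp : p ∈ repCosts s) (hq : q ∈ repCosts t) :
    p + q ∈ repCosts (s + t) := by
  obtain ⟨m, a, b, rfl, rfl⟩ := hp
  obtain ⟨n, c, d, rfl, rfl⟩ := hq
  exact ⟨m + n, Fin.append a c, Fin.append b d, by simp [Fin.sum_univ_add],
    by simp [Fin.sum_univ_add]⟩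

theorem repCosts_smul {t : E ⊗[ℂ] F} {p : ℝ} (hp : p ∈ repCosts t) (z : ℂ) :
    ‖z‖ * p ∈ repCosts (z • t) := by
  obtain ⟨n, a, b, rfl, rfl⟩ := hp
  exact ⟨n, fun i => z • a i, b, by simp [Finset.smul_sum, TensorProduct.smul_tmul'],
    by simp [Finset.mul_sum, norm_smul, mul_assoc]⟩

theorem repCosts_tmul (a : E) (b : F) : ‖a‖ * ‖b‖ ∈ repCosts (a ⊗ₜ[ℂ] b) :=
  ⟨1, fun _ => a, fun _ => b, by simp, by simp⟩

theorem repCosts_nonempty (t : E ⊗[ℂ] F) : (repCosts t).Nonempty := by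
  induction t with
  | zero => exact ⟨0, 0, Fin.elim0, Fin.elim0, by simp, by simp⟩
  | tmul a b => exact ⟨_, repCosts_tmul a b⟩
  | add s t hs ht =>
    obtain ⟨p, hp⟩ := hs
    obtain ⟨q, hq⟩ := ht
    exact ⟨_, repCosts_add hp hq⟩

theorem projNorm_nonneg (t : E ⊗[ℂ] F) : 0 ≤ projNorm t := by
  refine le_csInf (repCosts_nonempty t) ?_
  rintro r ⟨n, a, b, -, rfl⟩
  positivity

theorem projNorm_zero : projNorm (0 : E ⊗[ℂ] F) = 0 :=
  le_antisymm (csInf_le (repCosts_bddBelow _) ⟨0, Fin.elim0, Fin.elim0, by simp, by simp⟩)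
    (projNorm_nonneg _)

theorem projNorm_tmul_le (a : E) (b : F) : projNorm (a ⊗ₜ[ℂ] b) ≤ ‖a‖ * ‖b‖ :=
  csInf_le (repCosts_bddBelow _) (repCosts_tmul a b)

theorem projNorm_add_le (s t : E ⊗[ℂ] F) : projNorm (s + t) ≤ projNorm s + projNorm t := by
  refine le_of_forall_pos_le_add fun ε hε => ?_
  obtain ⟨p, hp, hp'⟩ := exists_lt_of_csInf_lt (repCosts_nonempty s)
    (show sInf (repCosts s) < projNorm s + ε / 2 from lt_add_of_pos_right _ (by positivity))
  obtain ⟨q, hq, hq'⟩ := exists_lt_of_csInf_lt (repCosts_nonempty t)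
    (show sInf (repCosts t) < projNorm t + ε / 2 from lt_add_of_pos_right _ (by positivity))
  have h : projNorm (s + t) ≤ p + q := csInf_le (repCosts_bddBelow _) (repCosts_add hp hq)
  linarith

theorem projNorm_smul_le (z : ℂ) (t : E ⊗[ℂ] F) : projNorm (z • t) ≤ ‖z‖ * projNorm t := by
  rcases eq_or_ne z 0 with rfl | hz
  · simp [projNorm_zero]
  · have hz' : 0 < ‖z‖ := norm_pos_iff.mpr hz
    rw [← div_le_iff₀' hz']
    refine le_csInf (repCosts_nonempty t) fun p hp => ?_
    rw [div_le_iff₀' hz']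
    exact csInf_le (repCosts_bddBelow _) (repCosts_smul hp z)

variable (E F) in
/-- The projective norm as a seminorm. -/
def projSeminorm : Seminorm ℂ (AlgTensor E F) :=
  Seminorm.ofSMulLE (fun t => projNorm (E := E) (F := F) t) projNorm_zero projNorm_add_le
    projNorm_smul_le

instance : SeminormedAddCommGroup (AlgTensor E F) :=
  AddGroupSeminorm.toSeminormedAddCommGroup (projSeminorm E F).toAddGroupSeminorm

instance : NormedSpace ℂ (AlgTensor E F) where
  norm_smul_le := projNorm_smul_le (E := E) (F := F)

variable (E F) in
/-- The projective tensor product `E ⊗̂ F`: the completion of `E ⊗ F` in the projective norm. -/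
abbrev ProjTensor : Type (max u v) := UniformSpace.Completion (AlgTensor E F)

/-- The canonical map `E ⊗ F → E ⊗̂ F`. -/
def toProj : E ⊗[ℂ] F →ₗ[ℂ] ProjTensor E F :=
  (UniformSpace.Completion.toComplL (𝕜 := ℂ) (E := AlgTensor E F)).toLinearMap

theorem norm_toProj (t : E ⊗[ℂ] F) : ‖toProj t‖ = projNorm t :=
  UniformSpace.Completion.norm_coe (E := AlgTensor E F) t

theorem denseRange_toProj : DenseRange (toProj (E := E) (F := F)) :=
  UniformSpace.Completion.denseRange_coe (α := AlgTensor E F)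

/-- The elementary tensor `a ⊗ b` in `E ⊗̂ F`. -/
def ptmul (a : E) (b : F) : ProjTensor E F := toProj (a ⊗ₜ[ℂ] b)

theorem add_ptmul (a a' : E) (b : F) : ptmul (a + a') b = ptmul a b + ptmul a' b := by
  rw [ptmul, TensorProduct.add_tmul, map_add, ptmul, ptmul]

theorem ptmul_add (a : E) (b b' : F) : ptmul a (b + b') = ptmul a b + ptmul a b' := by
  rw [ptmul, TensorProduct.tmul_add, map_add, ptmul, ptmul]

theorem smul_ptmul (z : ℂ) (a : E) (b : F) : ptmul (z • a) b = z • ptmul a b := by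
  rw [ptmul, ← TensorProduct.smul_tmul', map_smul, ptmul]

theorem ptmul_smul (z : ℂ) (a : E) (b : F) : ptmul a (z • b) = z • ptmul a b := by
  rw [ptmul, TensorProduct.tmul_smul, map_smul, ptmul]

variable {G : Type*} [NormedAddCommGroup G] [NormedSpace ℂ G]

theorem projTensor_ext {S R : ProjTensor E F →L[ℂ] G}
    (h : ∀ a b, S (ptmul a b) = R (ptmul a b)) : S = R := by
  have h' : S.toLinearMap ∘ₗ toProj = R.toLinearMap ∘ₗ toProj := TensorProduct.ext' h
  ext x
  exact congrFun (denseRange_toProj.equalizer S.continuous R.continuous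
    (funext fun t => LinearMap.congr_fun h' t)) x

/-- The linear map on `E ⊗ F` given by a bounded bilinear map. -/
def algLift (B : E →L[ℂ] F →L[ℂ] G) : E ⊗[ℂ] F →ₗ[ℂ] G :=
  TensorProduct.lift (LinearMap.mk₂ ℂ (fun a b => B a b) (by simp) (by simp) (by simp) (by simp))

@[simp]
theorem algLift_tmul (B : E →L[ℂ] F →L[ℂ] G) (a : E) (b : F) :
    algLift B (a ⊗ₜ[ℂ] b) = B a b := by
  simp [algLift]

theorem norm_algLift_le (B : E →L[ℂ] F →L[ℂ] G) (t : E ⊗[ℂ] F) :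
    ‖algLift B t‖ ≤ ‖B‖ * ‖toProj t‖ := by
  have key : ∀ p ∈ repCosts t, ‖algLift B t‖ ≤ ‖B‖ * p := by
    rintro p ⟨n, a, b, rfl, rfl⟩
    rw [map_sum, Finset.mul_sum]
    refine norm_sum_le_of_le _ fun i _ => ?_
    rw [algLift_tmul, ← mul_assoc]
    exact B.le_opNorm₂ (a i) (b i)
  rw [norm_toProj]
  rcases (norm_nonneg B).eq_or_lt with hB | hB
  · obtain ⟨p, hp⟩ := repCosts_nonempty t
    have := key p hp
    rw [← hB, zero_mul] at this ⊢
    exact this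
  · rw [← div_le_iff₀' hB]
    refine le_csInf (repCosts_nonempty t) fun p hp => ?_
    rw [div_le_iff₀' hB]
    exact key p hp

/-- The bounded linear map on `E ⊗̂ F` that sends `a ⊗ b` to `B a b`, for `B` bounded bilinear. -/
def plift [CompleteSpace G] (B : E →L[ℂ] F →L[ℂ] G) : ProjTensor E F →L[ℂ] G :=
  (algLift B).extendOfNorm toProj

@[simp]
theorem plift_ptmul [CompleteSpace G] (B : E →L[ℂ] F →L[ℂ] G) (a : E) (b : F) :
    plift B (ptmul a b) = B a b := by
  rw [plift, ptmul, LinearMap.extendOfNorm_eq denseRange_toProj ⟨_, norm_algLift_le B⟩,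
    algLift_tmul]

variable (E F) in
/-- The elementary tensor as a bounded bilinear map. -/
def ptmulL : E →L[ℂ] F →L[ℂ] ProjTensor E F :=
  LinearMap.mkContinuous₂
    (LinearMap.mk₂ ℂ ptmul add_ptmul smul_ptmul ptmul_add ptmul_smul) 1
    (fun a b => by
      rw [one_mul, LinearMap.mk₂_apply, ptmul, norm_toProj]
      exact projNorm_tmul_le a b)

@[simp]
theorem ptmulL_apply (a : E) (b : F) : ptmulL E F a b = ptmul a b := rfl

variable {E' F' : Type*} [NormedAddCommGroup E'] [NormedSpace ℂ E']
  [NormedAddCommGroup F'] [NormedSpace ℂ F']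

/-- The bounded linear map `S ⊗ R : E ⊗̂ F → E' ⊗̂ F'`. -/
def pmap (S : E →L[ℂ] E') (R : F →L[ℂ] F') : ProjTensor E F →L[ℂ] ProjTensor E' F' :=
  plift ((ptmulL E' F').bilinearComp S R)

@[simp]
theorem pmap_ptmul (S : E →L[ℂ] E') (R : F →L[ℂ] F') (a : E) (b : F) :
    pmap S R (ptmul a b) = ptmul (S a) (R b) := by
  simp [pmap]

end ProjectiveTensor

/-! ### Approximate diagonals and amenability

A complex Banach algebra is not assumed to have a unit. -/

section Algebra

variable (A : Type u) [NonUnitalNormedRing A] [NormedSpace ℂ A] [IsScalarTower ℂ A A]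
  [SMulCommClass ℂ A A]

variable {A} in
/-- The left module action `a · (b ⊗ c) = (a * b) ⊗ c` on `A ⊗̂ A`. -/
def lact (a : A) : ProjTensor A A →L[ℂ] ProjTensor A A :=
  pmap (ContinuousLinearMap.mul ℂ A a) (ContinuousLinearMap.id ℂ A)

variable {A} in
/-- The right module action `(b ⊗ c) · a = b ⊗ (c * a)` on `A ⊗̂ A`. -/
def ract (a : A) : ProjTensor A A →L[ℂ] ProjTensor A A :=
  pmap (ContinuousLinearMap.id ℂ A) ((ContinuousLinearMap.mul ℂ A).flip a)

/-- The product map `π (a ⊗ b) = a * b`. -/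
def prodMap [CompleteSpace A] : ProjTensor A A →L[ℂ] A :=
  plift (ContinuousLinearMap.mul ℂ A)

variable {A} in
/-- The net `d` is an approximate diagonal: `a · d i - d i · a → 0` and `π (d i) * a → a`. -/
structure IsApproxDiagonal [CompleteSpace A] {ι : Type w} [Preorder ι]
    (d : ι → ProjTensor A A) : Prop where
  comm : ∀ a : A, Filter.Tendsto (fun i => lact a (d i) - ract a (d i)) Filter.atTop (𝓝 0)
  prod : ∀ a : A, Filter.Tendsto (fun i => prodMap A (d i) * a) Filter.atTop (𝓝 a)

/-- `A` has a bounded approximate diagonal. -/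
def HasBoundedApproxDiagonal [CompleteSpace A] : Prop :=
  ∃ (ι : Type u) (_ : Preorder ι) (_ : IsDirectedOrder ι) (_ : Nonempty ι)
    (d : ι → ProjTensor A A), IsApproxDiagonal d ∧ ∃ C : ℝ, ∀ i, ‖d i‖ ≤ C

/-- A Banach `A`-bimodule structure on `E`: commuting left and right actions, `l a x = a · x` and
`r a x = x · a`, both bounded as bilinear maps. -/
structure BanachBimodule (E : Type v) [NormedAddCommGroup E] [NormedSpace ℂ E] where
  l : A →L[ℂ] E →L[ℂ] E
  r : A →L[ℂ] E →L[ℂ] E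
  l_mul : ∀ a b x, l (a * b) x = l a (l b x)
  r_mul : ∀ a b x, r (a * b) x = r b (r a x)
  l_r : ∀ a b x, l a (r b x) = r b (l a x)

variable {A} in
/-- `D` is a derivation into the dual bimodule of `E`, whose actions are
`(a · φ) x = φ (x · a)` and `(φ · a) x = φ (a · x)`: `D (a * b) = a · D b + D a · b`. -/
def IsDualDerivation {E : Type v} [NormedAddCommGroup E] [NormedSpace ℂ E]
    (S : BanachBimodule A E) (D : A →L[ℂ] StrongDual ℂ E) : Prop :=
  ∀ a b x, D (a * b) x = D b (S.r a x) + D a (S.l b x)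

variable {A} in
/-- `D` is inner: `D a = a · φ - φ · a` for some `φ` in the dual of `E`. -/
def IsInnerDual {E : Type v} [NormedAddCommGroup E] [NormedSpace ℂ E]
    (S : BanachBimodule A E) (D : A →L[ℂ] StrongDual ℂ E) : Prop :=
  ∃ φ : StrongDual ℂ E, ∀ a x, D a x = φ (S.r a x) - φ (S.l a x)

/-- `A` is amenable (Johnson): for each Banach `A`-bimodule `E`, every continuous derivation from `A` into
the dual bimodule of `E` is inner. -/
def Amenable : Prop :=
  ∀ (E : Type u) [NormedAddCommGroup E] [NormedSpace ℂ E] [CompleteSpace E]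
    (S : BanachBimodule A E) (D : A →L[ℂ] StrongDual ℂ E),
    IsDualDerivation S D → IsInnerDual S D

end Algebra

/-! ### The Grothendieck constant -/

/-- The constant `k` is admissible in Grothendieck's inequality for bounded bilinear forms on
`C(K₁) × C(K₂)`, for all (nonempty) compact Hausdorff spaces `K₁` and `K₂`. -/
def IsGrothendieckBound (k : ℝ≥0) : Prop :=
  ∀ (K₁ K₂ : Type u) [TopologicalSpace K₁] [CompactSpace K₁] [T2Space K₁] [Nonempty K₁]
    [MeasurableSpace K₁] [BorelSpace K₁]
    [TopologicalSpace K₂] [CompactSpace K₂] [T2Space K₂] [Nonempty K₂]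
    [MeasurableSpace K₂] [BorelSpace K₂]
    (Φ : C(K₁, ℂ) →L[ℂ] C(K₂, ℂ) →L[ℂ] ℂ),
    ∃ (μ₁ : MeasureTheory.Measure K₁) (μ₂ : MeasureTheory.Measure K₂),
      MeasureTheory.IsProbabilityMeasure μ₁ ∧ μ₁.Regular ∧
      MeasureTheory.IsProbabilityMeasure μ₂ ∧ μ₂.Regular ∧
      ∀ (x : C(K₁, ℂ)) (y : C(K₂, ℂ)),
        ‖Φ x y‖ ≤ k * ‖Φ‖ * √((∫ s, ‖x s‖ ^ 2 ∂μ₁) * ∫ t, ‖y t‖ ^ 2 ∂μ₂)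

/-- The complex Grothendieck constant `K_G`: the infimum of the admissible constants, as an element
of `[0, ∞]`. It is finite by Grothendieck's theorem, and the definition does not presuppose this. -/
def grothendieckConst : ℝ≥0∞ :=
  ⨅ (k : ℝ≥0) (_ : IsGrothendieckBound.{u} k), (k : ℝ≥0∞)

/-! ### The map `T` -/

section Mixed

variable {X : Type u} [TopologicalSpace X] [CompactSpace X]
  {A : Type v} [NormedAddCommGroup A] [NormedSpace ℂ A]

/-- For `f` in `C(X)`, the map `A → C(X, A)` that sends `a` to the function `x ↦ f x • a`. -/
def fnMul (f : C(X, ℂ)) : A →L[ℂ] C(X, A) :=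
  LinearMap.mkContinuous
    { toFun := fun a => ⟨fun x => f x • a, by fun_prop⟩
      map_add' := fun a b => by ext x; simp
      map_smul' := fun z a => by ext x; exact smul_comm (f x) z a } ‖f‖
    (fun a => by
      refine (ContinuousMap.norm_le _ (by positivity)).mpr fun x => ?_
      simp only [LinearMap.coe_mk, AddHom.coe_mk, ContinuousMap.coe_mk, norm_smul]
      gcongr
      exact f.norm_coe_le_norm x)

@[simp]
theorem fnMul_apply (f : C(X, ℂ)) (a : A) (x : X) : fnMul f a x = f x • a := rfl

theorem fnMul_add (f g : C(X, ℂ)) : fnMul (A := A) (f + g) = fnMul f + fnMul g := by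
  ext a x
  simp [add_smul]

theorem fnMul_smul (z : ℂ) (f : C(X, ℂ)) : fnMul (A := A) (z • f) = z • fnMul f := by
  ext a x
  simp [mul_smul]

variable (X A) in
/-- The map `T (∑ f i ⊗ g i, ∑ a j ⊗ b j) = ∑ f i a j ⊗ g i b j`, from
`(C(X) ⊗ C(X)) × (A ⊗̂ A)` to `C(X, A) ⊗̂ C(X, A)`. -/
def mixedT : C(X, ℂ) ⊗[ℂ] C(X, ℂ) →ₗ[ℂ]
    (ProjTensor A A →L[ℂ] ProjTensor C(X, A) C(X, A)) :=
  TensorProduct.lift (LinearMap.mk₂ ℂ (fun f g => pmap (fnMul f) (fnMul g))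
    (fun f f' g => projTensor_ext fun a b => by
      simp only [fnMul_add, pmap_ptmul, add_apply, add_ptmul])
    (fun z f g => projTensor_ext fun a b => by
      simp only [fnMul_smul, pmap_ptmul, smul_apply, smul_ptmul])
    (fun f g g' => projTensor_ext fun a b => by
      simp only [fnMul_add, pmap_ptmul, add_apply, ptmul_add])
    (fun z f g => projTensor_ext fun a b => by
      simp only [fnMul_smul, pmap_ptmul, smul_apply, ptmul_smul]))

theorem mixedT_tmul (f g : C(X, ℂ)) (a b : A) :
    mixedT X A (f ⊗ₜ[ℂ] g) (ptmul a b) = ptmul (fnMul f a) (fnMul g b) := by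
  simp [mixedT]

end Mixed

end

end BanachAmenability

open BanachAmenability

/-! The constant `K_G` enters only through `K_G ≥ 1`, which is seen on a one-point space: the
construction below gives `‖t‖_p ≤ 1` and `‖U_γ‖_p ≤ M`, at least as good as `2c = K_G` and `2cM`.
Grothendieck's inequality is not needed.

Diagonals for `C(X)`. If `u` is unitary with inverse `v`, the mean of `(u ⊗ v)^k` over `k < N` has
product `1` and projective norm at most `1`, and `u ⊗ 1 - 1 ⊗ u` times it telescopes to norm at most
`2/N`. In the commutative algebra `C(X) ⊗ C(X)`, products of such means serve finitely many
unitaries at once. Every `f` is a combination of four unitaries, so `exists_unitDiagonal` follows.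

Passage to `C(X, A)`. For the function `h a`, with `h` in `C(X)` and `a` in `A`, the commutator with
`T(t, α)` is `T((h ⊗ 1 - 1 ⊗ h) t, a·α) + T((1 ⊗ h) t, a·α - α·a)`, and `π(T(t, α))` is the constant
function `π(α)` when `t` has product `1`. Taking `t` first and `ν` afterwards makes all errors small
on finitely many functions `h a`. These span a dense subspace, and the uniform bound extends the
convergence to all of `C(X, A)` (`exists_mixedT_approxDiagonal`).

Amenability is translated by Johnson's theorem, proved here in both directions
(`amenable_iff_hasBoundedApproxDiagonal`). For the converse, evaluation at a point is a bounded
homomorphism onto `A`, and it carries bounded approximate diagonals along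
(`HasBoundedApproxDiagonal.of_surjective`). -/

namespace BanachAmenability

noncomputable section

open Filter

/-! ### Norm estimates in projective tensor products. -/

section Bounds

variable {E F G E' F' : Type*} [NormedAddCommGroup E] [NormedSpace ℂ E]
  [NormedAddCommGroup F] [NormedSpace ℂ F] [NormedAddCommGroup G] [NormedSpace ℂ G]
  [NormedAddCommGroup E'] [NormedSpace ℂ E'] [NormedAddCommGroup F'] [NormedSpace ℂ F']

theorem norm_plift_apply_le [CompleteSpace G] (B : E →L[ℂ] F →L[ℂ] G) (z : ProjTensor E F) :
    ‖plift B z‖ ≤ ‖B‖ * ‖z‖ := by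
  refine denseRange_toProj.induction_on z
    (isClosed_le (by fun_prop) (by fun_prop)) fun t => ?_
  rw [plift, LinearMap.extendOfNorm_eq denseRange_toProj ⟨_, norm_algLift_le B⟩]
  exact norm_algLift_le B t

theorem norm_ptmul_le (a : E) (b : F) : ‖ptmul a b‖ ≤ ‖a‖ * ‖b‖ := by
  rw [ptmul, norm_toProj]
  exact projNorm_tmul_le a b

theorem norm_pmap_apply_le (S : E →L[ℂ] E') (R : F →L[ℂ] F') (z : ProjTensor E F) :
    ‖pmap S R z‖ ≤ ‖S‖ * ‖R‖ * ‖z‖ := by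
  refine (norm_plift_apply_le _ z).trans ?_
  gcongr
  refine ContinuousLinearMap.opNorm_le_bound₂ _ (by positivity) fun a b => ?_
  calc ‖ptmul (S a) (R b)‖ ≤ ‖S a‖ * ‖R b‖ := norm_ptmul_le _ _
    _ ≤ (‖S‖ * ‖a‖) * (‖R‖ * ‖b‖) := by gcongr <;> exact ContinuousLinearMap.le_opNorm _ _
    _ = _ := by ring

theorem projTensor_ext_apply {S R : ProjTensor E F →L[ℂ] G}
    (h : ∀ a b, S (ptmul a b) = R (ptmul a b)) (z : ProjTensor E F) : S z = R z := by
  rw [projTensor_ext h]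

/-- A bound on elementary tensors for a linear map out of `E ⊗ F` is a bound for `projNorm`. -/
theorem norm_le_projNorm_of_tmul {V : Type*} [SeminormedAddCommGroup V] [NormedSpace ℂ V]
    (L : E ⊗[ℂ] F →ₗ[ℂ] V) {C : ℝ} (hC : 0 ≤ C)
    (h : ∀ a b, ‖L (a ⊗ₜ[ℂ] b)‖ ≤ C * (‖a‖ * ‖b‖)) (t : E ⊗[ℂ] F) :
    ‖L t‖ ≤ C * projNorm t := by
  have key : ∀ p ∈ repCosts t, ‖L t‖ ≤ C * p := by
    rintro p ⟨n, a, b, rfl, rfl⟩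
    rw [map_sum, Finset.mul_sum]
    exact norm_sum_le_of_le _ fun i _ => h _ _
  rw [projNorm, ← smul_eq_mul, ← Real.sInf_smul_of_nonneg hC]
  refine le_csInf ((repCosts_nonempty t).smul_set) ?_
  rintro _ ⟨p, hp, rfl⟩
  exact key p hp

end Bounds

/-! ### Approximate diagonals from finitely many conditions. -/

section Criterion

instance isDirectedOrder_finset_prod_nat {B : Type*} : IsDirectedOrder (Finset B × ℕ) where
  directed i j := by
    classical
    exact ⟨i ⊔ j, le_sup_left, le_sup_right⟩

/-- Finite approximability of a family of error functions yields a net. -/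
theorem tendsto_errors {B Z : Type*} (e : B → Z → ℝ) (he : ∀ b z, 0 ≤ e b z)
    {u : Finset B × ℕ → Z} (hu : ∀ i, ∀ b ∈ i.1, e b (u i) < 1 / ((i.2 : ℝ) + 1)) (b : B) :
    Tendsto (fun i => e b (u i)) atTop (𝓝 0) := by
  rw [Metric.tendsto_nhds]
  intro ε hε
  obtain ⟨n, hn⟩ := exists_nat_one_div_lt hε
  filter_upwards [eventually_ge_atTop ({b}, n)] with i hi
  have hb : b ∈ i.1 := hi.1 (Finset.mem_singleton_self b)
  rw [Real.dist_eq, sub_zero, abs_of_nonneg (he _ _)]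
  refine (hu i b hb).trans (lt_of_le_of_lt ?_ hn)
  have : n ≤ i.2 := hi.2
  gcongr

variable {A : Type u} [NonUnitalNormedRing A] [NormedSpace ℂ A] [IsScalarTower ℂ A A]
  [SMulCommClass ℂ A A] [CompleteSpace A]

theorem isApproxDiagonal_of_errors {u : Finset A × ℕ → ProjTensor A A}
    (hu : ∀ i, ∀ a ∈ i.1, ‖lact a (u i) - ract a (u i)‖ < 1 / ((i.2 : ℝ) + 1) ∧
      ‖prodMap A (u i) * a - a‖ < 1 / ((i.2 : ℝ) + 1)) : IsApproxDiagonal u where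
  comm a := tendsto_zero_iff_norm_tendsto_zero.2 <|
    tendsto_errors (fun a z => ‖lact a z - ract a z‖) (fun _ _ => norm_nonneg _)
      (fun i b hb => (hu i b hb).1) a
  prod a := tendsto_iff_norm_sub_tendsto_zero.2 <|
    tendsto_errors (fun a z => ‖prodMap A z * a - a‖) (fun _ _ => norm_nonneg _)
      (fun i b hb => (hu i b hb).2) a

theorem IsApproxDiagonal.exists_errors {ι : Type w} [Preorder ι] [IsDirectedOrder ι] [Nonempty ι]
    {d : ι → ProjTensor A A} (hd : IsApproxDiagonal d) (F : Finset A) {ε : ℝ} (hε : 0 < ε) :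
    ∃ i, ∀ a ∈ F, ‖lact a (d i) - ract a (d i)‖ < ε ∧ ‖prodMap A (d i) * a - a‖ < ε := by
  have h : ∀ a ∈ F, ∀ᶠ i in atTop,
      ‖lact a (d i) - ract a (d i)‖ < ε ∧ ‖prodMap A (d i) * a - a‖ < ε := fun a _ =>
    ((tendsto_zero_iff_norm_tendsto_zero.1 (hd.comm a)).eventually_lt_const hε).and
      ((tendsto_iff_norm_sub_tendsto_zero.1 (hd.prod a)).eventually_lt_const hε)
  exact ((Finset.eventually_all F).2 h).exists

/-- A bounded approximate diagonal exists as soon as finitely many conditions can be met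
approximately with a uniform bound. -/
theorem hasBoundedApproxDiagonal_iff :
    HasBoundedApproxDiagonal A ↔ ∃ C : ℝ, ∀ (F : Finset A) (ε : ℝ), 0 < ε →
      ∃ u : ProjTensor A A, ‖u‖ ≤ C ∧ ∀ a ∈ F, ‖lact a u - ract a u‖ < ε ∧
        ‖prodMap A u * a - a‖ < ε := by
  constructor
  · rintro ⟨ι, _, _, _, d, hd, C, hC⟩
    refine ⟨C, fun F ε hε => ?_⟩
    obtain ⟨i, hi⟩ := hd.exists_errors F hε
    exact ⟨d i, hC i, hi⟩
  · rintro ⟨C, h⟩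
    -- Finite sets paired with tolerances `1/(n+1)` form a directed set in the universe of `A`, as
    -- `HasBoundedApproxDiagonal` demands, whatever the original index set was.
    choose u hu hu' using fun i : Finset A × ℕ => h i.1 (1 / ((i.2 : ℝ) + 1)) (by positivity)
    exact ⟨Finset A × ℕ, inferInstance, inferInstance, inferInstance, u,
      isApproxDiagonal_of_errors hu', C, hu⟩

end Criterion

/-! ### The bimodule structure of `A ⊗̂ A`. -/

section Actions

variable {A : Type u} [NonUnitalNormedRing A] [NormedSpace ℂ A] [IsScalarTower ℂ A A]
  [SMulCommClass ℂ A A]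

@[simp]
theorem lact_ptmul (a b c : A) : lact a (ptmul b c) = ptmul (a * b) c := by
  simp [lact]

@[simp]
theorem ract_ptmul (a b c : A) : ract a (ptmul b c) = ptmul b (c * a) := by
  simp [ract]

@[simp]
theorem prodMap_ptmul [CompleteSpace A] (a b : A) : prodMap A (ptmul a b) = a * b := by
  simp [prodMap]

theorem norm_lact_apply_le (a : A) (z : ProjTensor A A) : ‖lact a z‖ ≤ ‖a‖ * ‖z‖ := by
  refine (norm_pmap_apply_le _ _ z).trans ?_
  have h1 := ContinuousLinearMap.opNorm_mul_apply_le ℂ A a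
  have h2 := ContinuousLinearMap.norm_id_le (𝕜 := ℂ) (E := A)
  calc _ ≤ ‖a‖ * 1 * ‖z‖ := by gcongr
    _ = _ := by ring

theorem norm_ract_apply_le (a : A) (z : ProjTensor A A) : ‖ract a z‖ ≤ ‖a‖ * ‖z‖ := by
  refine (norm_pmap_apply_le _ _ z).trans ?_
  have h1 : ‖(ContinuousLinearMap.mul ℂ A).flip a‖ ≤ ‖a‖ :=
    ContinuousLinearMap.opNorm_le_bound _ (norm_nonneg _) fun b => by
      simpa [mul_comm] using norm_mul_le b a
  have h2 := ContinuousLinearMap.norm_id_le (𝕜 := ℂ) (E := A)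
  calc _ ≤ 1 * ‖a‖ * ‖z‖ := by gcongr
    _ = _ := by ring

variable (A) in
/-- The left action `lact` as a bounded bilinear map. -/
def lactL : A →L[ℂ] ProjTensor A A →L[ℂ] ProjTensor A A :=
  LinearMap.mkContinuous₂
    (LinearMap.mk₂ ℂ (fun a z => lact a z)
      (fun a b z => projTensor_ext_apply (S := lact (a + b)) (R := lact a + lact b)
        (fun _ _ => by simp [add_mul, add_ptmul]) z)
      (fun c a z => projTensor_ext_apply (S := lact (c • a)) (R := c • lact a)
        (fun _ _ => by simp [smul_mul_assoc, smul_ptmul]) z)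
      (fun a _ _ => map_add _ _ _) (fun c a _ => map_smul _ _ _)) 1
    (fun a z => by simpa using norm_lact_apply_le a z)

variable (A) in
/-- The right action `ract` as a bounded bilinear map. -/
def ractL : A →L[ℂ] ProjTensor A A →L[ℂ] ProjTensor A A :=
  LinearMap.mkContinuous₂
    (LinearMap.mk₂ ℂ (fun a z => ract a z)
      (fun a b z => projTensor_ext_apply (S := ract (a + b)) (R := ract a + ract b)
        (fun _ _ => by simp [mul_add, ptmul_add]) z)
      (fun c a z => projTensor_ext_apply (S := ract (c • a)) (R := c • ract a)
        (fun _ _ => by simp [mul_smul_comm, ptmul_smul]) z)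
      (fun a _ _ => map_add _ _ _) (fun c a _ => map_smul _ _ _)) 1
    (fun a z => by simpa using norm_ract_apply_le a z)

@[simp]
theorem lactL_apply (a : A) : lactL A a = lact a := by ext; rfl

@[simp]
theorem ractL_apply (a : A) : ractL A a = ract a := by ext; rfl

theorem lact_mul (a b : A) (z : ProjTensor A A) : lact (a * b) z = lact a (lact b z) :=
  projTensor_ext_apply (R := (lact a).comp (lact b)) (fun _ _ => by simp [mul_assoc]) z

theorem ract_mul (a b : A) (z : ProjTensor A A) : ract (a * b) z = ract b (ract a z) :=
  projTensor_ext_apply (R := (ract b).comp (ract a)) (fun _ _ => by simp [mul_assoc]) z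

theorem lact_ract (a b : A) (z : ProjTensor A A) : lact a (ract b z) = ract b (lact a z) :=
  projTensor_ext_apply (S := (lact a).comp (ract b)) (R := (ract b).comp (lact a))
    (fun _ _ => by simp) z

variable [CompleteSpace A]

theorem prodMap_lact (a : A) (z : ProjTensor A A) : prodMap A (lact a z) = a * prodMap A z :=
  projTensor_ext_apply (S := (prodMap A).comp (lact a))
    (R := (ContinuousLinearMap.mul ℂ A a).comp (prodMap A)) (fun _ _ => by simp [mul_assoc]) z

theorem prodMap_ract (a : A) (z : ProjTensor A A) : prodMap A (ract a z) = prodMap A z * a :=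
  projTensor_ext_apply (S := (prodMap A).comp (ract a))
    (R := ((ContinuousLinearMap.mul ℂ A).flip a).comp (prodMap A))
    (fun _ _ => by simp [mul_assoc]) z

end Actions

/-! ### Weak-star limits along an ultrafilter. -/

section Limits

variable {ι V W : Type*} [NormedAddCommGroup V] [NormedSpace ℂ V] [NormedAddCommGroup W]
  [NormedSpace ℂ W]

theorem exists_tendsto_ultrafilter (l : Ultrafilter ι) {f : ι → ℂ} {C : ℝ}
    (hf : ∀ i, ‖f i‖ ≤ C) : ∃ z, Tendsto f l (𝓝 z) := by
  obtain ⟨z, -, hz⟩ := (isCompact_closedBall (0 : ℂ) C).ultrafilter_le_nhds (l.map f)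
    (by simp [Set.preimage, hf])
  exact ⟨z, hz⟩

theorem exists_bound_image (B : V →L[ℂ] W) {e : ι → V} {C : ℝ} (he : ∀ i, ‖e i‖ ≤ C) :
    ∃ K : ℝ, ∀ i, ‖B (e i)‖ ≤ K :=
  ⟨‖B‖ * C, fun i => (B.le_opNorm _).trans (by gcongr; exact he i)⟩

/-- This replaces weak-star compactness: bounded scalars converge along any ultrafilter, so one
fixed ultrafilter serves all the limits of a proof without passing to subnets. -/
theorem exists_bilinear_limit (l : Ultrafilter ι) {L : ι → V →L[ℂ] W →L[ℂ] ℂ} {C : ℝ}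
    (hC : ∀ i, ‖L i‖ ≤ C) :
    ∃ M : V →L[ℂ] W →L[ℂ] ℂ, ∀ x y, Tendsto (fun i => L i x y) l (𝓝 (M x y)) := by
  have hb : ∀ i x y, ‖L i x y‖ ≤ C * ‖x‖ * ‖y‖ := fun i x y =>
    ((L i).le_opNorm₂ x y).trans (by gcongr; exact hC i)
  choose M hM using fun x y => exists_tendsto_ultrafilter l (fun i => hb i x y)
  refine ⟨LinearMap.mkContinuous₂ (LinearMap.mk₂ ℂ M ?_ ?_ ?_ ?_) C fun x y => ?_, hM⟩
  · intro x x' y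
    refine tendsto_nhds_unique (hM _ _) ?_
    simpa using (hM x y).add (hM x' y)
  · intro c x y
    refine tendsto_nhds_unique (hM _ _) ?_
    simpa using (hM x y).const_mul c
  · intro x y y'
    refine tendsto_nhds_unique (hM _ _) ?_
    simpa using (hM x y).add (hM x y')
  · intro c x y
    refine tendsto_nhds_unique (hM _ _) ?_
    simpa using (hM x y).const_mul c
  · exact le_of_tendsto (hM x y).norm (Eventually.of_forall fun i => hb i x y)

theorem exists_linear_limit (l : Ultrafilter ι) {f : ι → StrongDual ℂ V} {C : ℝ}
    (hC : ∀ i, ‖f i‖ ≤ C) :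
    ∃ g : StrongDual ℂ V, ∀ x, Tendsto (fun i => f i x) l (𝓝 (g x)) := by
  obtain ⟨M, hM⟩ := exists_bilinear_limit l
    (L := fun i => ContinuousLinearMap.toSpanSingleton ℂ (f i)) (C := C)
    (fun i => by simpa using hC i)
  exact ⟨M 1, fun x => by simpa using hM 1 x⟩

end Limits

/-! ### Johnson's theorem: a bounded approximate diagonal gives amenability. -/

section DiagonalToAmenable

variable {A : Type u} [NonUnitalNormedRing A] [NormedSpace ℂ A]
  {E : Type w} [NormedAddCommGroup E] [NormedSpace ℂ E]

namespace BanachBimodule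

/-- The bounded bilinear map `(a, b) ↦ a · D b` into the dual of `E`. -/
def leftDual (S : BanachBimodule A E) (D : A →L[ℂ] StrongDual ℂ E) :
    A →L[ℂ] A →L[ℂ] StrongDual ℂ E :=
  ((((ContinuousLinearMap.compL ℂ E E ℂ).flip).comp S.r).flip.comp D).flip

@[simp]
theorem leftDual_apply (S : BanachBimodule A E) (D : A →L[ℂ] StrongDual ℂ E) (a b : A) (x : E) :
    S.leftDual D a b x = D b (S.r a x) := rfl

variable [IsScalarTower ℂ A A] [SMulCommClass ℂ A A] (S : BanachBimodule A E)

theorem plift_leftDual_lact (D : A →L[ℂ] StrongDual ℂ E) (a : A) (x : E) (z : ProjTensor A A) :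
    plift (S.leftDual D) (lact a z) x = plift (S.leftDual D) z (S.r a x) :=
  projTensor_ext_apply
    (S := (ContinuousLinearMap.apply ℂ ℂ x).comp ((plift (S.leftDual D)).comp (lact a)))
    (R := (ContinuousLinearMap.apply ℂ ℂ (S.r a x)).comp (plift (S.leftDual D)))
    (fun b c => by simp [S.r_mul]) z

/-- On elementary tensors this is the derivation rule `b · D(ca) = (bc) · D a + (b · D c) · a`. -/
theorem plift_leftDual_ract [CompleteSpace A] {D : A →L[ℂ] StrongDual ℂ E}
    (hD : IsDualDerivation S D) (a : A)
    (x : E) (z : ProjTensor A A) :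
    plift (S.leftDual D) (ract a z) x
      = D a (S.r (prodMap A z) x) + plift (S.leftDual D) z (S.l a x) :=
  projTensor_ext_apply
    (S := (ContinuousLinearMap.apply ℂ ℂ x).comp ((plift (S.leftDual D)).comp (ract a)))
    (R := ((D a).comp (S.r.flip x)).comp (prodMap A)
      + (ContinuousLinearMap.apply ℂ ℂ (S.l a x)).comp (plift (S.leftDual D)))
    (fun b c => by
      simp only [ContinuousLinearMap.comp_apply, ract_ptmul, plift_ptmul, prodMap_ptmul,
        ContinuousLinearMap.apply_apply, leftDual_apply, add_apply,
        ContinuousLinearMap.flip_apply]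
      rw [hD c a, S.r_mul, S.l_r, add_comm]) z

end BanachBimodule

variable [IsScalarTower ℂ A A] [SMulCommClass ℂ A A] [CompleteSpace A]

/-- Applying `π` to `a · d i - d i · a` shows that `π (d i)` asymptotically commutes with `a`, so
the one-sided unit condition gives the other side. -/
theorem IsApproxDiagonal.tendsto_mul_prodMap {ι : Type*} [Preorder ι] {d : ι → ProjTensor A A}
    (hd : IsApproxDiagonal d) (a : A) :
    Tendsto (fun i => a * prodMap A (d i)) atTop (𝓝 a) := by
  have h := ((prodMap A).continuous.tendsto 0).comp (hd.comm a)
  have h' := h.add (hd.prod a)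
  simpa [Function.comp_def, prodMap_lact, prodMap_ract] using h'

/-- Johnson's theorem: derivations of an algebra with a bounded approximate diagonal into dual
bimodules are inner. The bimodule need not be essential. -/
theorem IsApproxDiagonal.isInnerDual {ι : Type*} [Preorder ι] [IsDirectedOrder ι] [Nonempty ι]
    {d : ι → ProjTensor A A} (hd : IsApproxDiagonal d) {C : ℝ} (hC : ∀ i, ‖d i‖ ≤ C)
    (S : BanachBimodule A E) {D : A →L[ℂ] StrongDual ℂ E} (hD : IsDualDerivation S D) :
    IsInnerDual S D := by
  set l : Ultrafilter ι := Ultrafilter.of atTop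
  have hl : (l : Filter ι) ≤ atTop := Ultrafilter.of_le atTop
  set e : ι → A := fun i => prodMap A (d i)
  have he : ∀ i, ‖e i‖ ≤ ‖prodMap A‖ * C := fun i =>
    ((prodMap A).le_opNorm _).trans (by gcongr; exact hC i)
  have hel : ∀ a, Tendsto (fun i => e i * a) l (𝓝 a) := fun a => (hd.prod a).mono_left hl
  have her : ∀ a, Tendsto (fun i => a * e i) l (𝓝 a) := fun a =>
    (hd.tendsto_mul_prodMap a).mono_left hl
  -- With `d i = ∑ b ⊗ c`, the functional `φ` is the limit of `∑ b · D c`, the usual candidate for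
  -- implementing `D`. Its commutators turn out to be `M a = lim e i · D a`.
  obtain ⟨φ, hφ⟩ := exists_linear_limit l (f := fun i => plift (S.leftDual D) (d i))
    (C := ‖plift (S.leftDual D)‖ * C)
    (fun i => ((plift (S.leftDual D)).le_opNorm _).trans (by gcongr; exact hC i))
  obtain ⟨K, hK⟩ := exists_bound_image (W := A →L[ℂ] StrongDual ℂ E) (S.leftDual D) he
  obtain ⟨M, hM⟩ := exists_bilinear_limit l hK
  replace hM : ∀ a x, Tendsto (fun i => D a (S.r (e i) x)) l (𝓝 (M a x)) := hM
  have hφM : ∀ a x, φ (S.r a x) - φ (S.l a x) = M a x := by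
    intro a x
    refine tendsto_nhds_unique ((hφ (S.r a x)).sub (hφ (S.l a x))) ?_
    have h1 : Tendsto (fun i => plift (S.leftDual D) (lact a (d i) - ract a (d i)) x) l (𝓝 0) := by
      have := (((ContinuousLinearMap.apply ℂ ℂ x).comp
        (plift (S.leftDual D))).continuous.tendsto 0).comp ((hd.comm a).mono_left hl)
      simpa [Function.comp_def] using this
    have h2 := h1.add (hM a x)
    rw [zero_add] at h2
    refine h2.congr fun i => ?_
    rw [map_sub, sub_apply, S.plift_leftDual_lact, S.plift_leftDual_ract hD]
    ring
  -- If the elements `x · b` spanned `E` densely, this would give `M = D` and end the proof. In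
  -- general `D - M` vanishes on these elements and must be shown inner separately.
  have hr : ∀ a b x, M a (S.r b x) = D a (S.r b x) := by
    intro a b x
    refine tendsto_nhds_unique (hM _ _) ?_
    have := ((((D a).comp (S.r.flip x))).continuous.tendsto b).comp (her b)
    simpa [Function.comp_def, S.r_mul] using this
  have hmul : ∀ a b x, M (a * b) x = D b (S.r a x) + M a (S.l b x) := by
    intro a b x
    refine tendsto_nhds_unique (hM _ _) ?_
    have := (((((D b).comp (S.r.flip x))).continuous.tendsto a).comp (hel a)).add (hM a (S.l b x))
    refine this.congr fun i => ?_
    rw [hD, S.l_r]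
    simp [S.r_mul]
  -- By `hmul`, `(D - M)(ab) = (D - M)(a) · b`. Hence the limit `ψ` of `(D - M)(e i)` satisfies `ψ ·
  -- a = (D - M)(a)` and `a · ψ = 0`, so `-ψ` implements `D - M`.
  obtain ⟨ψ, hψ⟩ := exists_linear_limit l (f := fun i => (D - M) (e i))
    (C := ‖D - M‖ * (‖prodMap A‖ * C))
    (fun i => ((D - M).le_opNorm _).trans (by gcongr; exact he i))
  have hψl : ∀ a x, ψ (S.l a x) = D a x - M a x := by
    intro a x
    refine tendsto_nhds_unique (hψ _) ?_
    have := ((((D - M).flip x)).continuous.tendsto a).comp (hel a)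
    refine this.congr fun i => ?_
    simp only [Function.comp_apply, ContinuousLinearMap.flip_apply, sub_apply, hmul, hD (e i) a x]
    ring
  have hψr : ∀ a x, ψ (S.r a x) = 0 := by
    intro a x
    refine tendsto_nhds_unique (hψ _) ?_
    simp [hr]
  refine ⟨φ - ψ, fun a x => ?_⟩
  simp only [sub_apply, hψl, hψr]
  linear_combination -hφM a x

theorem HasBoundedApproxDiagonal.amenable (h : HasBoundedApproxDiagonal A) : Amenable A := by
  obtain ⟨ι, _, _, _, d, hd, C, hC⟩ := h
  intro E _ _ _ S D hD
  exact hd.isInnerDual hC S hD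

end DiagonalToAmenable

/-! ### Norm approximation from elements of the bidual. -/

section Bidual

variable {Z Y : Type*} [NormedAddCommGroup Z] [NormedSpace ℂ Z] [NormedAddCommGroup Y]
  [NormedSpace ℂ Y]

/-- If a bidual element `Φ` satisfies `T** Φ = y` with `y` in the space itself, then `y` is
approximated by values of `T` on the ball of radius `‖Φ‖`. -/
theorem mem_closure_image_of_bidual (T : Z →L[ℂ] Y) (y : Y)
    (Φ : StrongDual ℂ (StrongDual ℂ Z)) (h : ∀ f : StrongDual ℂ Y, Φ (f.comp T) = f y) :
    y ∈ closure (T '' Metric.closedBall 0 ‖Φ‖) := by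
  by_contra hy
  have hconv : Convex ℝ (closure (T '' Metric.closedBall 0 ‖Φ‖)) :=
    ((convex_closedBall (0 : Z) ‖Φ‖).linear_image (T.toLinearMap.restrictScalars ℝ)).closure
  obtain ⟨f, s, hs, hsy⟩ :=
    RCLike.geometric_hahn_banach_closed_point (𝕜 := ℂ) hconv isClosed_closure hy
  have hre : ∀ z ∈ Metric.closedBall (0 : Z) ‖Φ‖, RCLike.re (f (T z)) < s := fun z hz =>
    hs _ (subset_closure ⟨z, hz, rfl⟩)
  -- The ball is invariant under unimodular scalars, so the bound on real parts is a bound on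
  -- moduli.
  have hnorm : ∀ z ∈ Metric.closedBall (0 : Z) ‖Φ‖, ‖(f.comp T) z‖ ≤ s := by
    intro z hz
    obtain ⟨c, hc, hcz⟩ := RCLike.exists_norm_eq_mul_self (f (T z))
    have := hre (c • z) (by simpa [norm_smul, hc] using hz)
    rw [map_smul, map_smul, smul_eq_mul, ← hcz, RCLike.ofReal_re] at this
    exact this.le
  have hle : ‖Φ‖ * ‖f.comp T‖ ≤ s := by
    rcases (norm_nonneg Φ).eq_or_lt with h0 | h0
    · rw [← h0, zero_mul]
      simpa using (hre 0 (Metric.mem_closedBall_self h0.le)).le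
    · rw [← le_div_iff₀' h0]
      exact ContinuousLinearMap.opNorm_bound_of_ball_bound h0 s _ hnorm
  have : RCLike.re (f y) ≤ ‖Φ‖ * ‖f.comp T‖ := by
    rw [← h f]
    exact (RCLike.re_le_norm _).trans (Φ.le_opNorm _)
  linarith

/-- Finitely many conditions become one for the joint map into the product `κ → Y`. Separating from
a closed convex set yields norm approximation, not merely weak approximation. -/
theorem exists_approx_of_bidual {κ : Type*} [Fintype κ] (T : κ → Z →L[ℂ] Y) (y : κ → Y)
    (Φ : StrongDual ℂ (StrongDual ℂ Z))
    (h : ∀ k (f : StrongDual ℂ Y), Φ (f.comp (T k)) = f (y k)) {ε : ℝ} (hε : 0 < ε) :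
    ∃ z, ‖z‖ ≤ ‖Φ‖ ∧ ∀ k, ‖T k z - y k‖ < ε := by
  classical
  have hmem := mem_closure_image_of_bidual (ContinuousLinearMap.pi T) y Φ fun f => by
    have hf : f.comp (ContinuousLinearMap.pi T)
        = ∑ k, (f.comp (ContinuousLinearMap.single ℂ (fun _ : κ => Y) k)).comp (T k) := by
      ext z
      simp only [ContinuousLinearMap.comp_apply, sum_apply,
        ContinuousLinearMap.single_apply]
      rw [← map_sum, Finset.univ_sum_single]
      rfl
    rw [hf, map_sum]
    simp only [h, ContinuousLinearMap.comp_apply, ContinuousLinearMap.single_apply]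
    rw [← map_sum, Finset.univ_sum_single]
  obtain ⟨_, ⟨z, hz, rfl⟩, hzε⟩ := Metric.mem_closure_iff.1 hmem ε hε
  refine ⟨z, by simpa using hz, fun k => ?_⟩
  rw [← dist_eq_norm, dist_comm]
  exact (dist_le_pi_dist y _ k).trans_lt hzε

end Bidual

/-! ### Bilinear maps on quotients, and adjoint actions. -/

section Quotient

variable {A E G : Type*} [NormedAddCommGroup A] [NormedSpace ℂ A] [NormedAddCommGroup E]
  [NormedSpace ℂ E] [NormedAddCommGroup G] [NormedSpace ℂ G]

/-- Bounded bilinear maps vanishing on `W` in the second variable descend to `E ⧸ W`. -/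
def quotientLift₂ (W : Submodule ℂ E) [IsClosed (W : Set E)] (B : A →L[ℂ] E →L[ℂ] G)
    (h : ∀ a, ∀ x ∈ W, B a x = 0) : A →L[ℂ] (E ⧸ W) →L[ℂ] G :=
  LinearMap.mkContinuous₂
    (LinearMap.mk₂ ℂ (fun a q => W.liftQ (B a).toLinearMap (fun x hx => h a x hx) q)
      (fun a b q => by
        obtain ⟨x, rfl⟩ := Submodule.Quotient.mk_surjective _ q
        change B (a + b) x = B a x + B b x
        simp)
      (fun c a q => by
        obtain ⟨x, rfl⟩ := Submodule.Quotient.mk_surjective _ q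
        change B (c • a) x = c • B a x
        simp)
      (fun a _ _ => map_add _ _ _) (fun c a _ => map_smul _ _ _)) ‖B‖ <| by
    intro a q
    refine le_of_forall_pos_le_add fun ε hε => ?_
    -- The slack in the choice of a representative costs at most `ε` after multiplication by `‖B‖ *
    -- ‖a‖`; the `+ 1` keeps the denominator positive.
    have hδ : 0 < ε / (‖B‖ * ‖a‖ + 1) := by positivity
    obtain ⟨x, rfl, hx⟩ := Submodule.Quotient.norm_mk_lt q hδ
    calc ‖B a x‖ ≤ ‖B‖ * ‖a‖ * ‖x‖ := B.le_opNorm₂ a x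
      _ ≤ ‖B‖ * ‖a‖ * (‖(Submodule.Quotient.mk x : E ⧸ W)‖ + ε / (‖B‖ * ‖a‖ + 1)) := by gcongr
      _ = ‖B‖ * ‖a‖ * ‖(Submodule.Quotient.mk x : E ⧸ W)‖
          + (‖B‖ * ‖a‖) / (‖B‖ * ‖a‖ + 1) * ε := by ring
      _ ≤ _ := by
        have h1 : (‖B‖ * ‖a‖) / (‖B‖ * ‖a‖ + 1) ≤ 1 := by
          rw [div_le_one (by positivity)]
          linarith
        have := mul_le_mul_of_nonneg_right h1 hε.le
        linarith

@[simp]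
theorem quotientLift₂_mk (W : Submodule ℂ E) [IsClosed (W : Set E)] (B : A →L[ℂ] E →L[ℂ] G)
    (h : ∀ a, ∀ x ∈ W, B a x = 0) (a : A) (x : E) :
    quotientLift₂ W B h a (Submodule.Quotient.mk x) = B a x := rfl

variable (A) in
/-- The adjoint of an action: `a ↦ (ψ ↦ ψ ∘ B a)`. -/
def dualAction (B : A →L[ℂ] E →L[ℂ] E) : A →L[ℂ] StrongDual ℂ E →L[ℂ] StrongDual ℂ E :=
  (ContinuousLinearMap.compL ℂ E E ℂ).flip.comp B

@[simp]
theorem dualAction_apply (B : A →L[ℂ] E →L[ℂ] E) (a : A) (ψ : StrongDual ℂ E) :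
    dualAction A B a ψ = ψ.comp (B a) := rfl

end Quotient

/-! ### Johnson's theorem: amenability gives a bounded approximate diagonal. -/

section AmenableToDiagonal

variable {A : Type u} [NonUnitalNormedRing A] [NormedSpace ℂ A]

/-- The quotient of a Banach bimodule by a closed sub-bimodule. -/
def BanachBimodule.quotient {E : Type v} [NormedAddCommGroup E] [NormedSpace ℂ E]
    (S : BanachBimodule A E) (W : Submodule ℂ E) [IsClosed (W : Set E)]
    (hl : ∀ a, ∀ x ∈ W, S.l a x ∈ W) (hr : ∀ a, ∀ x ∈ W, S.r a x ∈ W) :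
    BanachBimodule A (E ⧸ W) where
  l := quotientLift₂ W ((ContinuousLinearMap.compL ℂ E E (E ⧸ W) W.mkQL).comp S.l)
    (fun a x hx => (Submodule.Quotient.mk_eq_zero W).2 (hl a x hx))
  r := quotientLift₂ W ((ContinuousLinearMap.compL ℂ E E (E ⧸ W) W.mkQL).comp S.r)
    (fun a x hx => (Submodule.Quotient.mk_eq_zero W).2 (hr a x hx))
  l_mul a b q := by
    obtain ⟨x, rfl⟩ := Submodule.Quotient.mk_surjective _ q
    exact congrArg (Submodule.Quotient.mk (p := W)) (S.l_mul a b x)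
  r_mul a b q := by
    obtain ⟨x, rfl⟩ := Submodule.Quotient.mk_surjective _ q
    exact congrArg (Submodule.Quotient.mk (p := W)) (S.r_mul a b x)
  l_r a b q := by
    obtain ⟨x, rfl⟩ := Submodule.Quotient.mk_surjective _ q
    exact congrArg (Submodule.Quotient.mk (p := W)) (S.l_r a b x)

/-- For an amenable algebra, a functional that is central on a closed sub-bimodule agrees there
with a functional that is central everywhere. -/
theorem Amenable.exists_central (hA : Amenable A) {E : Type u} [NormedAddCommGroup E]
    [NormedSpace ℂ E] [CompleteSpace E] (S : BanachBimodule A E) (W : Submodule ℂ E)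
    (hW : IsClosed (W : Set E))
    (hl : ∀ a, ∀ x ∈ W, S.l a x ∈ W) (hr : ∀ a, ∀ x ∈ W, S.r a x ∈ W) (Φ : StrongDual ℂ E)
    (hΦ : ∀ a, ∀ x ∈ W, Φ (S.r a x) = Φ (S.l a x)) :
    ∃ M : StrongDual ℂ E, (∀ x ∈ W, M x = Φ x) ∧ ∀ a x, M (S.r a x) = M (S.l a x) := by
  -- The inner derivation `a ↦ a · Φ - Φ · a` annihilates `W`, so it takes values in the dual of `E
  -- ⧸ W`. Amenability gives `N` implementing it there, and `Φ - N` is central and unchanged on `W`.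
  set D : A →L[ℂ] StrongDual ℂ (E ⧸ W) :=
    quotientLift₂ W ((ContinuousLinearMap.compL ℂ E E ℂ Φ).comp (S.r - S.l))
      (fun a x hx => by simp [hΦ a x hx]) with hDdef
  have hD : ∀ a x, D a (Submodule.Quotient.mk x) = Φ (S.r a x) - Φ (S.l a x) := fun a x => by
    simp [D]
  obtain ⟨N, hN⟩ := hA (E ⧸ W) (S.quotient W hl hr) D (fun a b q => by
    obtain ⟨x, rfl⟩ := Submodule.Quotient.mk_surjective _ q
    have h1 : (S.quotient W hl hr).r a (Submodule.Quotient.mk x)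
      = Submodule.Quotient.mk (S.r a x) := rfl
    have h2 : (S.quotient W hl hr).l b (Submodule.Quotient.mk x)
      = Submodule.Quotient.mk (S.l b x) := rfl
    rw [h1, h2]
    simp only [hD, S.r_mul, S.l_mul, S.l_r]
    ring)
  refine ⟨Φ - N.comp W.mkQL, fun x hx => ?_, fun a x => ?_⟩
  · have : W.mkQL x = 0 := (Submodule.Quotient.mk_eq_zero W).2 hx
    simp only [sub_apply, ContinuousLinearMap.comp_apply, this, map_zero, sub_zero]
  · have h := hN a (Submodule.Quotient.mk x)
    rw [hD] at h
    change Φ (S.r a x) - N (Submodule.Quotient.mk (S.r a x))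
      = Φ (S.l a x) - N (Submodule.Quotient.mk (S.l a x))
    have h' : Φ (S.r a x) - Φ (S.l a x) = N (Submodule.Quotient.mk (S.r a x))
      - N (Submodule.Quotient.mk (S.l a x)) := h
    linear_combination h'

variable [IsScalarTower ℂ A A] [SMulCommClass ℂ A A]

/-- With zero left action on `A*`, the embedding of `A` into `A**` is a derivation. A `Φ`
implementing it satisfies `Φ(f(a ·)) = f(a)`, hence acts as a right unit in the bidual, and is then
approximated from `A`. -/
theorem Amenable.exists_right_approxUnit (hA : Amenable A) :
    ∃ C : ℝ, 0 ≤ C ∧ ∀ (F : Finset A) (ε : ℝ), 0 < ε →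
      ∃ e : A, ‖e‖ ≤ C ∧ ∀ a ∈ F, ‖a * e - a‖ < ε := by
  let S : BanachBimodule A (StrongDual ℂ A) :=
    { l := 0
      r := dualAction A (ContinuousLinearMap.mul ℂ A)
      l_mul := by simp
      r_mul := fun a b ψ => by ext x; simp [mul_assoc]
      l_r := by simp }
  obtain ⟨Φ, hΦ⟩ := hA _ S (NormedSpace.inclusionInDoubleDual ℂ A) fun a b ψ => by
    simp [S]
  refine ⟨‖Φ‖, norm_nonneg _, fun F ε hε => ?_⟩
  obtain ⟨e, he, h⟩ := exists_approx_of_bidual (κ := F)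
    (fun a => ContinuousLinearMap.mul ℂ A (a : A)) (fun a => (a : A)) Φ
    (fun a f => by simpa [S] using (hΦ a f).symm) hε
  exact ⟨e, he, fun a ha => h ⟨a, ha⟩⟩

theorem Amenable.exists_left_approxUnit (hA : Amenable A) :
    ∃ C : ℝ, 0 ≤ C ∧ ∀ (F : Finset A) (ε : ℝ), 0 < ε →
      ∃ e : A, ‖e‖ ≤ C ∧ ∀ a ∈ F, ‖e * a - a‖ < ε := by
  let S : BanachBimodule A (StrongDual ℂ A) :=
    { l := dualAction A (ContinuousLinearMap.mul ℂ A).flip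
      r := 0
      r_mul := by simp
      l_mul := fun a b ψ => by ext x; simp [mul_assoc]
      l_r := by simp }
  obtain ⟨Φ, hΦ⟩ := hA _ S (NormedSpace.inclusionInDoubleDual ℂ A) fun a b ψ => by
    simp [S]
  -- The nonzero action now enters an inner derivation with a minus sign, hence `-Φ`.
  refine ⟨‖-Φ‖, norm_nonneg _, fun F ε hε => ?_⟩
  obtain ⟨e, he, h⟩ := exists_approx_of_bidual (κ := F)
    (fun a => (ContinuousLinearMap.mul ℂ A).flip (a : A)) (fun a => (a : A)) (-Φ)
    (fun a f => by simpa [S] using (hΦ a f).symm) hε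
  exact ⟨e, he, fun a ha => h ⟨a, ha⟩⟩

/-- Formally `1 - (e + f - e f) = (1 - e)(1 - f)`, so a right unit `e` controls the errors on one
side and a left unit `f` those on the other. -/
theorem Amenable.exists_approxUnit (hA : Amenable A) :
    ∃ C : ℝ, ∀ (F : Finset A) (ε : ℝ), 0 < ε →
      ∃ e : A, ‖e‖ ≤ C ∧ ∀ a ∈ F, ‖a * e - a‖ < ε ∧ ‖e * a - a‖ < ε := by
  obtain ⟨C₁, hC₁, h₁⟩ := hA.exists_right_approxUnit
  obtain ⟨C₂, hC₂, h₂⟩ := hA.exists_left_approxUnit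
  refine ⟨C₁ + C₂ + C₁ * C₂, fun F ε hε => ?_⟩
  obtain ⟨e, he, heF⟩ := h₁ F (ε / (1 + C₂)) (by positivity)
  obtain ⟨f, hf, hfF⟩ := h₂ F (ε / (1 + C₁)) (by positivity)
  refine ⟨e + f - e * f, ?_, fun a ha => ⟨?_, ?_⟩⟩
  · calc ‖e + f - e * f‖ ≤ ‖e‖ + ‖f‖ + ‖e‖ * ‖f‖ :=
        (norm_sub_le _ _).trans (add_le_add (norm_add_le _ _) (norm_mul_le _ _))
      _ ≤ _ := by gcongr
  · have h : a * (e + f - e * f) - a = (a * e - a) - (a * e - a) * f := by noncomm_ring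
    rw [h]
    calc _ ≤ ‖a * e - a‖ + ‖a * e - a‖ * ‖f‖ :=
        (norm_sub_le _ _).trans (add_le_add le_rfl (norm_mul_le _ _))
      _ ≤ ‖a * e - a‖ + ‖a * e - a‖ * C₂ := by gcongr
      _ = ‖a * e - a‖ * (1 + C₂) := by ring
      _ < ε := (lt_div_iff₀ (by positivity)).1 (heF a ha)
  · have h : (e + f - e * f) * a - a = (f * a - a) - e * (f * a - a) := by noncomm_ring
    rw [h]
    calc _ ≤ ‖f * a - a‖ + ‖e‖ * ‖f * a - a‖ :=
        (norm_sub_le _ _).trans (add_le_add le_rfl (norm_mul_le _ _))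
      _ ≤ ‖f * a - a‖ + C₁ * ‖f * a - a‖ := by gcongr
      _ = ‖f * a - a‖ * (1 + C₁) := by ring
      _ < ε := (lt_div_iff₀ (by positivity)).1 (hfF a ha)

variable [CompleteSpace A]

variable (A) in
/-- The dual bimodule of `A ⊗̂ A`. -/
def dualTensorBimodule : BanachBimodule A (StrongDual ℂ (ProjTensor A A)) where
  l := dualAction A (ractL A)
  r := dualAction A (lactL A)
  l_mul a b ψ := by ext z; simp [ract_mul]
  r_mul a b ψ := by ext z; simp [lact_mul]
  l_r a b ψ := by ext z; simp [lact_ract]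

/-- Johnson's theorem: an amenable Banach algebra has a bounded approximate diagonal. -/
theorem Amenable.hasBoundedApproxDiagonal (hA : Amenable A) : HasBoundedApproxDiagonal A := by
  obtain ⟨C, hC⟩ := hA.exists_approxUnit
  choose g hg hgF using fun i : Finset A × ℕ => hC i.1 (1 / ((i.2 : ℝ) + 1)) (by positivity)
  set l : Ultrafilter (Finset A × ℕ) := Ultrafilter.of atTop
  have hl : (l : Filter (Finset A × ℕ)) ≤ atTop := Ultrafilter.of_le atTop
  have hgr : ∀ a, Tendsto (fun i => a * g i) l (𝓝 a) := fun a =>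
    (tendsto_iff_norm_sub_tendsto_zero.2 <| tendsto_errors (fun a z => ‖a * z - a‖)
      (fun _ _ => norm_nonneg _) (fun i b hb => (hgF i b hb).1) a).mono_left hl
  have hgl : ∀ a, Tendsto (fun i => g i * a) l (𝓝 a) := fun a =>
    (tendsto_iff_norm_sub_tendsto_zero.2 <| tendsto_errors (fun a z => ‖z * a - a‖)
      (fun _ _ => norm_nonneg _) (fun i b hb => (hgF i b hb).2) a).mono_left hl
  have hgg : ∀ a, Tendsto (fun i => g i * (g i * a)) l (𝓝 a) := by
    intro a
    have h1 : Tendsto (fun i => g i * (g i * a - a)) l (𝓝 0) := by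
      refine squeeze_zero_norm (a := fun i => C * ‖g i * a - a‖)
        (fun i => (norm_mul_le _ _).trans (by gcongr; exact hg i)) ?_
      simpa using (tendsto_iff_norm_sub_tendsto_zero.1 (hgl a)).const_mul C
    simpa [mul_sub] using h1.add (hgl a)
  have hgg' : ∀ a, Tendsto (fun i => a * g i * g i) l (𝓝 a) := by
    intro a
    have h1 : Tendsto (fun i => (a * g i - a) * g i) l (𝓝 0) := by
      refine squeeze_zero_norm (a := fun i => ‖a * g i - a‖ * C)
        (fun i => (norm_mul_le _ _).trans (by gcongr; exact hg i)) ?_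
      simpa using (tendsto_iff_norm_sub_tendsto_zero.1 (hgr a)).mul_const C
    simpa [sub_mul] using h1.add (hgr a)
  -- `Φ` is a weak-star limit of `g i ⊗ g i` in the bidual of `A ⊗̂ A`. Since `π (g i ⊗ g i) = g i *
  -- g i` is again an approximate unit, `Φ` has the right product but need not be central.
  obtain ⟨Φ, hΦ⟩ := exists_linear_limit l
    (f := fun i => NormedSpace.inclusionInDoubleDual ℂ (ProjTensor A A) (ptmul (g i) (g i)))
    (C := C * C) (fun i => (NormedSpace.double_dual_bound ℂ _ _).trans <|
      (norm_ptmul_le _ _).trans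
        (mul_le_mul (hg i) (hg i) (norm_nonneg _) ((norm_nonneg _).trans (hg i))))
  simp only [NormedSpace.dual_def] at hΦ
  set S := dualTensorBimodule A
  have hSl : ∀ a ψ, S.l a ψ = ψ.comp (ract a) := fun a ψ => by simp [S, dualTensorBimodule]
  have hSr : ∀ a ψ, S.r a ψ = ψ.comp (lact a) := fun a ψ => by simp [S, dualTensorBimodule]
  set P : StrongDual ℂ A →L[ℂ] StrongDual ℂ (ProjTensor A A) :=
    (ContinuousLinearMap.compL ℂ (ProjTensor A A) A ℂ).flip (prodMap A)
  have hP : ∀ φ, P φ = φ.comp (prodMap A) := fun φ => rfl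
  have hPl : ∀ a φ, S.l a (P φ) = P (φ.comp ((ContinuousLinearMap.mul ℂ A).flip a)) :=
    fun a φ => by ext z; simp [hSl, hP, prodMap_ract]
  have hPr : ∀ a φ, S.r a (P φ) = P (φ.comp (ContinuousLinearMap.mul ℂ A a)) :=
    fun a φ => by ext z; simp [hSr, hP, prodMap_lact]
  -- `W` is the closed range of the adjoint `P` of `π`. On it `Φ` is already central, because there
  -- both actions by `a` evaluate to `φ a`; `Amenable.exists_central` then corrects `Φ` without
  -- disturbing its product.
  set W : Submodule ℂ (StrongDual ℂ (ProjTensor A A)) :=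
    (LinearMap.range P.toLinearMap).topologicalClosure
  have hPW : ∀ φ, P φ ∈ W := fun φ =>
    Submodule.le_topologicalClosure _ (LinearMap.mem_range_self _ φ)
  have hind : ∀ {p : StrongDual ℂ (ProjTensor A A) → Prop}, IsClosed {x | p x} →
      (∀ φ, p (P φ)) → ∀ x ∈ W, p x := fun {p} hp h x hx =>
    closure_minimal (by rintro _ ⟨φ, rfl⟩; exact h φ) hp hx
  have hWc : IsClosed (W : Set (StrongDual ℂ (ProjTensor A A))) :=
    Submodule.isClosed_topologicalClosure _
  obtain ⟨M, hM, hMc⟩ := hA.exists_central S W hWc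
    (fun a => hind (hWc.preimage (S.l a).continuous) fun φ => by rw [hPl]; exact hPW _)
    (fun a => hind (hWc.preimage (S.r a).continuous) fun φ => by rw [hPr]; exact hPW _) Φ
    (fun a => hind (isClosed_eq (by fun_prop) (by fun_prop)) fun φ => by
      refine tendsto_nhds_unique (hΦ _) ?_ |>.trans
        (tendsto_nhds_unique (hΦ _) ?_ : Φ (S.l a (P φ)) = φ a).symm
      · simp only [hPr]
        simpa [hP, Function.comp_def, mul_assoc] using (φ.continuous.tendsto a).comp (hgg' a)
      · simp only [hPl]
        simpa [hP, Function.comp_def, mul_assoc] using (φ.continuous.tendsto a).comp (hgg a))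
  have hMP : ∀ a (φ : StrongDual ℂ A),
      M (P (φ.comp ((ContinuousLinearMap.mul ℂ A).flip a))) = φ a := fun a φ => by
    rw [hM _ (hPW _)]
    refine tendsto_nhds_unique (hΦ _) ?_
    simpa [hP, Function.comp_def, mul_assoc] using (φ.continuous.tendsto a).comp (hgg a)
  refine hasBoundedApproxDiagonal_iff.2 ⟨‖M‖, fun F ε hε => ?_⟩
  -- Commutator and product conditions are paired in `(A ⊗̂ A) × A`, so that a single `u` meets
  -- both.
  obtain ⟨u, hu, h⟩ := exists_approx_of_bidual (κ := F)
    (fun a => (lact (a : A) - ract (a : A)).prod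
      (((ContinuousLinearMap.mul ℂ A).flip (a : A)).comp (prodMap A)))
    (fun a => ((0 : ProjTensor A A), (a : A))) M
    (fun a f => by
      have hf : f.comp ((lact (a : A) - ract (a : A)).prod
          (((ContinuousLinearMap.mul ℂ A).flip (a : A)).comp (prodMap A)))
          = (S.r a (f.comp (ContinuousLinearMap.inl ℂ _ _))
              - S.l a (f.comp (ContinuousLinearMap.inl ℂ _ _)))
            + P ((f.comp (ContinuousLinearMap.inr ℂ _ _)).comp
              ((ContinuousLinearMap.mul ℂ A).flip (a : A))) := by
        ext z
        rw [hSl, hSr, hP]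
        simp only [add_apply, sub_apply, ContinuousLinearMap.comp_apply,
          ContinuousLinearMap.prod_apply, ContinuousLinearMap.inl_apply,
          ContinuousLinearMap.inr_apply]
        rw [← map_sub, ← map_add]
        simp
      rw [hf, map_add, map_sub, hMc, sub_self, zero_add, hMP]
      simp) hε
  refine ⟨u, hu, fun a ha => ?_⟩
  have := h ⟨a, ha⟩
  rw [Prod.norm_def, max_lt_iff] at this
  simpa using this

theorem amenable_iff_hasBoundedApproxDiagonal : Amenable A ↔ HasBoundedApproxDiagonal A :=
  ⟨Amenable.hasBoundedApproxDiagonal, HasBoundedApproxDiagonal.amenable⟩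

end AmenableToDiagonal

/-! ### Contractive diagonals in a commutative algebra. -/

section ProjNormMul

variable {R : Type*} [NormedCommRing R] [NormedAlgebra ℂ R]

theorem projNorm_mul_le (s t : R ⊗[ℂ] R) : projNorm (s * t) ≤ projNorm s * projNorm t := by
  rw [← norm_toProj, mul_comm (projNorm s)]
  refine norm_le_projNorm_of_tmul ((toProj (E := R) (F := R)) ∘ₗ LinearMap.mulRight ℂ t)
    (projNorm_nonneg t) (fun a b => ?_) s
  rw [mul_comm (projNorm t)]
  refine norm_le_projNorm_of_tmul ((toProj (E := R) (F := R)) ∘ₗ LinearMap.mulLeft ℂ (a ⊗ₜ b))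
    (by positivity) (fun c d => ?_) t
  simp only [LinearMap.comp_apply, LinearMap.mulLeft_apply, Algebra.TensorProduct.tmul_mul_tmul]
  rw [norm_toProj]
  calc projNorm ((a * c) ⊗ₜ[ℂ] (b * d)) ≤ ‖a * c‖ * ‖b * d‖ := projNorm_tmul_le _ _
    _ ≤ (‖a‖ * ‖c‖) * (‖b‖ * ‖d‖) := by gcongr <;> exact norm_mul_le _ _
    _ = _ := by ring

theorem projNorm_sum_le {κ : Type*} (F : Finset κ) (s : κ → R ⊗[ℂ] R) :
    projNorm (∑ k ∈ F, s k) ≤ ∑ k ∈ F, projNorm (s k) := by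
  simp only [← norm_toProj, map_sum]
  exact norm_sum_le _ _

theorem projNorm_sub_le (s t : R ⊗[ℂ] R) : projNorm (s - t) ≤ projNorm s + projNorm t := by
  simp only [← norm_toProj, map_sub]
  exact norm_sub_le _ _

variable (R) in
/-- The linear map `f ↦ f ⊗ 1 - 1 ⊗ f`. -/
def commTensor : R →ₗ[ℂ] R ⊗[ℂ] R :=
  (TensorProduct.mk ℂ R R).flip 1 - TensorProduct.mk ℂ R R 1

@[simp]
theorem commTensor_apply (f : R) : commTensor R f = f ⊗ₜ 1 - 1 ⊗ₜ f := rfl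

/-- Elements `t` of `R ⊗ R` of projective norm at most one with product one. -/
def IsUnitDiagonal (t : R ⊗[ℂ] R) : Prop :=
  LinearMap.mul' ℂ R t = 1 ∧ projNorm t ≤ 1

theorem IsUnitDiagonal.mul {s t : R ⊗[ℂ] R} (hs : IsUnitDiagonal s) (ht : IsUnitDiagonal t) :
    IsUnitDiagonal (s * t) := by
  refine ⟨?_, (projNorm_mul_le s t).trans (mul_le_one₀ hs.2 (projNorm_nonneg t) ht.2)⟩
  have := map_mul (Algebra.TensorProduct.lmul' ℂ (S := R)) s t
  rw [← AlgHom.toLinearMap_apply, ← AlgHom.toLinearMap_apply, ← AlgHom.toLinearMap_apply,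
    Algebra.TensorProduct.lmul'_toLinearMap, hs.1, ht.1, one_mul] at this
  exact this

theorem isUnitDiagonal_one (h : ‖(1 : R)‖ ≤ 1) : IsUnitDiagonal (1 : R ⊗[ℂ] R) := by
  constructor
  · rw [Algebra.TensorProduct.one_def, LinearMap.mul'_apply, one_mul]
  · rw [Algebra.TensorProduct.one_def]
    exact (projNorm_tmul_le _ _).trans (mul_le_one₀ h (norm_nonneg _) h)

/-- Multiply the individual diagonals: `R ⊗ R` is commutative and each factor has norm at most one,
so a further factor cannot enlarge a commutator already made small. -/
theorem exists_common_unitDiagonal (h1 : ‖(1 : R)‖ ≤ 1) {κ : Type*} (F : Finset κ) (f : κ → R)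
    (ε : κ → ℝ)
    (h : ∀ k ∈ F, ∃ t, IsUnitDiagonal t ∧ projNorm (commTensor R (f k) * t) < ε k) :
    ∃ t, IsUnitDiagonal t ∧ ∀ k ∈ F, projNorm (commTensor R (f k) * t) < ε k := by
  classical
  induction F using Finset.induction_on with
  | empty => exact ⟨1, isUnitDiagonal_one h1, by simp⟩
  | insert j F hj ih =>
    obtain ⟨t, ht, htF⟩ := ih fun k hk => h k (Finset.mem_insert_of_mem hk)
    obtain ⟨s, hs, hsj⟩ := h j (Finset.mem_insert_self j F)
    refine ⟨t * s, ht.mul hs, fun k hk => ?_⟩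
    rcases Finset.mem_insert.1 hk with rfl | hk
    · rw [mul_left_comm]
      exact ((projNorm_mul_le _ _).trans
        (mul_le_of_le_one_left (projNorm_nonneg _) ht.2)).trans_lt hsj
    · rw [← mul_assoc]
      exact ((projNorm_mul_le _ _).trans
        (mul_le_of_le_one_right (projNorm_nonneg _) hs.2)).trans_lt (htF k hk)

/-- Averaging `u ^ n ⊗ v ^ n` for `u` invertible with inverse `v`, both of norm at most one. -/
theorem exists_unitDiagonal_of_mul_eq_one (h1 : ‖(1 : R)‖ ≤ 1) {u v : R} (huv : u * v = 1)
    (hu : ‖u‖ ≤ 1) (hv : ‖v‖ ≤ 1) {ε : ℝ} (hε : 0 < ε) :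
    ∃ t, IsUnitDiagonal t ∧ projNorm (commTensor R u * t) < ε := by
  obtain ⟨n, hn⟩ := exists_nat_one_div_lt (show 0 < ε / 2 by positivity)
  set N : ℕ := n + 1
  have hN : (0 : ℝ) < (N : ℝ) := by positivity
  have hN' : (N : ℂ) ≠ 0 := by exact_mod_cast hN.ne'
  set x : R ⊗[ℂ] R := u ⊗ₜ v with hx
  have hxd : IsUnitDiagonal x :=
    ⟨by rw [hx, LinearMap.mul'_apply, huv],
      (projNorm_tmul_le _ _).trans (mul_le_one₀ hu (norm_nonneg _) hv)⟩
  have hxn : ∀ k : ℕ, IsUnitDiagonal (x ^ k) := fun k => by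
    induction k with
    | zero => simpa using isUnitDiagonal_one h1
    | succ k ih => rw [pow_succ]; exact ih.mul hxd
  refine ⟨(N : ℂ)⁻¹ • ∑ k ∈ Finset.range N, x ^ k, ⟨?_, ?_⟩, ?_⟩
  · rw [map_smul, map_sum, Finset.sum_congr rfl fun k _ => (hxn k).1, Finset.sum_const,
      Finset.card_range, ← Nat.cast_smul_eq_nsmul ℂ, inv_smul_smul₀ hN']
  · refine (projNorm_smul_le _ _).trans ?_
    calc ‖(N : ℂ)⁻¹‖ * projNorm (∑ k ∈ Finset.range N, x ^ k)
        ≤ (N : ℝ)⁻¹ * ∑ k ∈ Finset.range N, (1 : ℝ) := by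
          rw [norm_inv, Complex.norm_natCast]
          gcongr
          exact (projNorm_sum_le _ _).trans (Finset.sum_le_sum fun k _ => (hxn k).2)
      _ = 1 := by simp [hN.ne']
  -- As `u * v = 1`, `(1 ⊗ u)(u ⊗ v) = u ⊗ 1`. The factor `x - 1` telescopes the geometric sum to `x
  -- ^ N - 1`, of norm at most `2`.
  · have hc : commTensor R u = (1 ⊗ₜ u) * (x - 1) := by
      rw [commTensor_apply, mul_sub, mul_one, hx, Algebra.TensorProduct.tmul_mul_tmul, one_mul,
        huv]
    rw [hc, mul_smul_comm, mul_assoc, mul_geom_sum]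
    calc _ ≤ ‖(N : ℂ)⁻¹‖ * projNorm ((1 ⊗ₜ u) * (x ^ N - 1)) := projNorm_smul_le _ _
      _ ≤ (N : ℝ)⁻¹ * (1 * (1 + 1)) := by
        rw [norm_inv, Complex.norm_natCast]
        gcongr
        refine (projNorm_mul_le _ _).trans ?_
        gcongr
        · exact projNorm_nonneg _
        · exact (projNorm_tmul_le _ _).trans (mul_le_one₀ h1 (norm_nonneg _) hu)
        · exact (projNorm_sub_le _ _).trans
            (add_le_add (hxn N).2 (isUnitDiagonal_one h1).2)
      _ = 2 * (1 / ((n : ℝ) + 1)) := by simp only [N]; push_cast; ring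
      _ < ε := by linarith

end ProjNormMul

/-! ### Contractive diagonals for `C(X)`. -/

section ContinuousFunctions

variable {X : Type u} [TopologicalSpace X] [CompactSpace X]

theorem norm_one_continuousMap_le : ‖(1 : C(X, ℂ))‖ ≤ 1 :=
  (ContinuousMap.norm_le _ zero_le_one).2 fun x => by simp

theorem norm_unitary_continuousMap_le (u : unitary C(X, ℂ)) : ‖(u : C(X, ℂ))‖ ≤ 1 := by
  refine (ContinuousMap.norm_le _ zero_le_one).2 fun x => ?_
  have h : star ((u : C(X, ℂ)) x) * (u : C(X, ℂ)) x = 1 :=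
    congrArg (fun f : C(X, ℂ) => f x) (Unitary.coe_star_mul_self u)
  have h' := congrArg norm h
  rw [norm_mul, norm_star, norm_one] at h'
  nlinarith [norm_nonneg ((u : C(X, ℂ)) x)]

/-- `f` is a combination of four unitaries, and one diagonal serves all four; tolerances are
weighted by the coefficients. -/
theorem exists_unitDiagonal_comm (f : C(X, ℂ)) {ε : ℝ} (hε : 0 < ε) :
    ∃ t, IsUnitDiagonal t ∧ projNorm (commTensor C(X, ℂ) f * t) < ε := by
  obtain ⟨u, c, hf, -⟩ := CStarAlgebra.exists_sum_four_unitary f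
  have hδ : ∀ i, 0 < ε / 4 / (‖c i‖ + 1) := fun i => by positivity
  obtain ⟨t, ht, hti⟩ := exists_common_unitDiagonal norm_one_continuousMap_le Finset.univ
    (fun i => (u i : C(X, ℂ))) (fun i => ε / 4 / (‖c i‖ + 1)) fun i _ =>
      exists_unitDiagonal_of_mul_eq_one norm_one_continuousMap_le (Unitary.coe_mul_star_self (u i))
        (norm_unitary_continuousMap_le _) (norm_unitary_continuousMap_le (star (u i))) (hδ i)
  refine ⟨t, ht, ?_⟩
  rw [hf, map_sum, Finset.sum_mul]
  refine (projNorm_sum_le _ _).trans_lt ?_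
  calc _ < ∑ _i : Fin 4, ε / 4 := Finset.sum_lt_sum_of_nonempty Finset.univ_nonempty fun i hi => by
        rw [map_smul, smul_mul_assoc]
        refine (projNorm_smul_le _ _).trans_lt ?_
        have := (lt_div_iff₀ (by positivity)).1 (hti i hi)
        nlinarith [projNorm_nonneg (commTensor C(X, ℂ) (u i : C(X, ℂ)) * t), norm_nonneg (c i)]
    _ = ε := by simp; ring

/-- `C(X)` has an approximate diagonal in `C(X) ⊗ C(X)` of projective norm at most one. -/
theorem exists_unitDiagonal {κ : Type*} (F : Finset κ) (f : κ → C(X, ℂ)) (ε : κ → ℝ)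
    (hε : ∀ k ∈ F, 0 < ε k) :
    ∃ t, IsUnitDiagonal t ∧ ∀ k ∈ F, projNorm (commTensor C(X, ℂ) (f k) * t) < ε k :=
  exists_common_unitDiagonal norm_one_continuousMap_le F f ε fun k hk =>
    exists_unitDiagonal_comm (f k) (hε k hk)

end ContinuousFunctions

/-! ### Density of the span of the functions `f a` in `C(X, A)`. -/

section Density

/-- Convergence to zero of a uniformly bounded net of operators may be checked on a set with dense
span. -/
theorem tendsto_zero_of_dense_span {ι V W : Type*} [NormedAddCommGroup V] [NormedSpace ℂ V]
    [NormedAddCommGroup W] [NormedSpace ℂ W] {l : Filter ι} {L : ι → V →L[ℂ] W} {K : ℝ}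
    (hK : ∀ i v, ‖L i v‖ ≤ K * ‖v‖) {s : Set V} (hs : ∀ v ∈ s, Tendsto (fun i => L i v) l (𝓝 0))
    {v : V} (hv : v ∈ closure (Submodule.span ℂ s : Set V)) :
    Tendsto (fun i => L i v) l (𝓝 0) := by
  have hspan : ∀ v ∈ Submodule.span ℂ s, Tendsto (fun i => L i v) l (𝓝 0) := fun v hv => by
    induction hv using Submodule.span_induction with
    | mem v hv => exact hs v hv
    | zero => simpa using tendsto_const_nhds
    | add v w _ _ hv hw => simpa using hv.add hw
    | smul c v _ hv => simpa using hv.const_smul c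
  rw [Metric.tendsto_nhds]
  intro ε hε
  obtain ⟨w, hw, hvw⟩ := Metric.mem_closure_iff.1 hv (ε / 2 / (|K| + 1)) (by positivity)
  filter_upwards [(tendsto_zero_iff_norm_tendsto_zero.1 (hspan w hw)).eventually_lt_const
    (half_pos hε)] with i hi
  rw [dist_zero_right]
  have h1 : ‖L i (v - w)‖ ≤ ε / 2 := by
    rw [dist_eq_norm] at hvw
    have := (lt_div_iff₀ (by positivity)).1 hvw
    have h2 := hK i (v - w)
    have h3 := mul_le_mul_of_nonneg_right (le_abs_self K) (norm_nonneg (v - w))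
    nlinarith [norm_nonneg (v - w)]
  calc ‖L i v‖ = ‖L i (v - w) + L i w‖ := by rw [← map_add, sub_add_cancel]
    _ ≤ ‖L i (v - w)‖ + ‖L i w‖ := norm_add_le _ _
    _ < ε := by linarith

variable {X : Type u} [TopologicalSpace X] [CompactSpace X] [T2Space X]
  {A : Type v} [NormedAddCommGroup A] [NormedSpace ℂ A]

/-- The functions `f • a` with `f` in `C(X)` and `a` in `A` span a dense subspace of `C(X, A)`. -/
theorem mem_closure_span_fnMul (f : C(X, A)) :
    f ∈ closure (Submodule.span ℂ
      (Set.range fun p : C(X, ℂ) × A => fnMul p.1 p.2) : Set C(X, A)) := by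
  rw [Metric.mem_closure_iff]
  intro ε hε
  obtain ⟨F, hF⟩ := isCompact_univ.elim_nhds_subcover
    (fun x => {y | ‖f y - f x‖ < ε / 2})
    (fun x _ => (isOpen_lt (by fun_prop) continuous_const).mem_nhds (by simpa using hε))
  let p : Fin F.card → X := fun i => (F.equivFin.symm i : X)
  -- A partition of unity subordinate to sets where `f` varies by less than `ε / 2`: the approximant
  -- averages the sampled values of `f`.
  obtain ⟨g, hg, hg1, hg01, -⟩ := exists_continuous_sum_one_of_isOpen_isCompact
    (s := fun i => {y | ‖f y - f (p i)‖ < ε / 2}) (t := Set.univ)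
    (fun i => isOpen_lt (by fun_prop) continuous_const) isCompact_univ (fun y _ => by
      obtain ⟨x, hx, hxy⟩ := Set.mem_iUnion₂.1 (hF.2 (Set.mem_univ y))
      exact Set.mem_iUnion.2 ⟨F.equivFin ⟨x, hx⟩, by simpa [p] using hxy⟩)
  let gc : Fin F.card → C(X, ℂ) := fun i => ⟨fun x => (g i x : ℂ), by fun_prop⟩
  refine ⟨∑ i, fnMul (gc i) (f (p i)),
    Submodule.sum_mem _ fun i _ => Submodule.subset_span ⟨(gc i, f (p i)), rfl⟩, ?_⟩
  rw [dist_eq_norm]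
  refine lt_of_le_of_lt ((ContinuousMap.norm_le _ (half_pos hε).le).2 fun y => ?_) (half_lt_self hε)
  have hsum : ∑ i, g i y = 1 := by simpa using hg1 (Set.mem_univ y)
  have hsumc : ∑ i, gc i y = 1 := by
    simpa [gc] using congrArg (fun r : ℝ => (r : ℂ)) hsum
  have hy : (f - ∑ i, fnMul (gc i) (f (p i))) y = ∑ i, gc i y • (f y - f (p i)) := by
    simp only [ContinuousMap.sub_apply, ContinuousMap.sum_apply, fnMul_apply, smul_sub,
      Finset.sum_sub_distrib, ← Finset.sum_smul, hsumc, one_smul]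
  rw [hy]
  calc ‖∑ i, gc i y • (f y - f (p i))‖ ≤ ∑ i, g i y * (ε / 2) :=
        norm_sum_le_of_le _ fun i _ => by
          have h0 := (hg01 i y).1
          have hn : ‖gc i y‖ = g i y := by simp [gc, abs_of_nonneg h0]
          rw [norm_smul, hn]
          rcases h0.eq_or_lt with h0 | h0
          · simp [← h0]
          · have hyi : y ∈ tsupport (g i) := subset_tsupport _ h0.ne'
            have : ‖f y - f (p i)‖ < ε / 2 := hg i hyi
            gcongr
    _ = ε / 2 := by rw [← Finset.sum_mul, hsum, one_mul]

end Density

/-! ### Approximate diagonals of the form `T(t, α)`. -/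

section MixedT

variable {X : Type u} [TopologicalSpace X] [CompactSpace X]

theorem norm_fnMul_le {A : Type v} [NormedAddCommGroup A] [NormedSpace ℂ A] (f : C(X, ℂ)) :
    ‖fnMul (A := A) f‖ ≤ ‖f‖ :=
  LinearMap.mkContinuous_norm_le _ (norm_nonneg f) _

theorem norm_fnMul_apply_le {A : Type v} [NormedAddCommGroup A] [NormedSpace ℂ A] (f : C(X, ℂ))
    (a : A) : ‖fnMul f a‖ ≤ ‖f‖ * ‖a‖ :=
  (ContinuousMap.norm_le _ (by positivity)).2 fun x => by
    rw [fnMul_apply, norm_smul]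
    gcongr
    exact f.norm_coe_le_norm x

theorem norm_mixedT_apply_le {A : Type v} [NormedAddCommGroup A] [NormedSpace ℂ A]
    (t : C(X, ℂ) ⊗[ℂ] C(X, ℂ)) (z : ProjTensor A A) :
    ‖mixedT X A t z‖ ≤ projNorm t * ‖z‖ := by
  rw [mul_comm]
  refine norm_le_projNorm_of_tmul
    ((ContinuousLinearMap.apply ℂ (ProjTensor C(X, A) C(X, A)) z).toLinearMap ∘ₗ mixedT X A)
    (norm_nonneg z) (fun f g => ?_) t
  calc ‖mixedT X A (f ⊗ₜ[ℂ] g) z‖ = ‖pmap (fnMul f) (fnMul g) z‖ := by simp [mixedT]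
    _ ≤ ‖fnMul (A := A) f‖ * ‖fnMul (A := A) g‖ * ‖z‖ := norm_pmap_apply_le _ _ _
    _ ≤ ‖f‖ * ‖g‖ * ‖z‖ := by gcongr <;> exact norm_fnMul_le _
    _ = _ := mul_comm _ _

variable {A : Type v} [NonUnitalNormedRing A] [NormedSpace ℂ A] [IsScalarTower ℂ A A]
  [SMulCommClass ℂ A A]

theorem fnMul_mul_fnMul (f g : C(X, ℂ)) (a b : A) :
    fnMul f a * fnMul g b = fnMul (f * g) (a * b) := by
  ext x
  simp [smul_mul_smul_comm]

/-- The action separates into a `C(X)` part on `t` and an `A` part on `z`. In `ract_mixedT`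
commutativity of `C(X)` likewise turns the scalar part into multiplication by `1 ⊗ h`. -/
theorem lact_mixedT (h : C(X, ℂ)) (a : A) (t : C(X, ℂ) ⊗[ℂ] C(X, ℂ)) (z : ProjTensor A A) :
    lact (fnMul h a) (mixedT X A t z) = mixedT X A ((h ⊗ₜ 1) * t) (lact a z) := by
  induction t with
  | zero => simp
  | add s t hs ht => simp only [map_add, mul_add, add_apply, hs, ht]
  | tmul f g =>
    refine projTensor_ext_apply (S := (lact (fnMul h a)).comp (mixedT X A (f ⊗ₜ g)))
      (R := (mixedT X A ((h ⊗ₜ 1) * (f ⊗ₜ g))).comp (lact a)) (fun b c => ?_) z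
    simp [mixedT_tmul, fnMul_mul_fnMul]

theorem ract_mixedT (h : C(X, ℂ)) (a : A) (t : C(X, ℂ) ⊗[ℂ] C(X, ℂ)) (z : ProjTensor A A) :
    ract (fnMul h a) (mixedT X A t z) = mixedT X A ((1 ⊗ₜ h) * t) (ract a z) := by
  induction t with
  | zero => simp
  | add s t hs ht => simp only [map_add, mul_add, add_apply, hs, ht]
  | tmul f g =>
    refine projTensor_ext_apply (S := (ract (fnMul h a)).comp (mixedT X A (f ⊗ₜ g)))
      (R := (mixedT X A ((1 ⊗ₜ h) * (f ⊗ₜ g))).comp (ract a)) (fun b c => ?_) z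
    simp [mixedT_tmul, fnMul_mul_fnMul, mul_comm g h]

theorem norm_lact_sub_ract_mixedT_le {h : C(X, ℂ)} {a : A} {t : C(X, ℂ) ⊗[ℂ] C(X, ℂ)}
    (ht : IsUnitDiagonal t) (z : ProjTensor A A) :
    ‖lact (fnMul h a) (mixedT X A t z) - ract (fnMul h a) (mixedT X A t z)‖
      ≤ projNorm (commTensor C(X, ℂ) h * t) * (‖a‖ * ‖z‖) + ‖h‖ * ‖lact a z - ract a z‖ := by
  have hsplit : lact (fnMul h a) (mixedT X A t z) - ract (fnMul h a) (mixedT X A t z)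
      = mixedT X A (commTensor C(X, ℂ) h * t) (lact a z)
        + mixedT X A ((1 ⊗ₜ h) * t) (lact a z - ract a z) := by
    rw [lact_mixedT, ract_mixedT, commTensor_apply, sub_mul, map_sub, sub_apply, map_sub]
    abel
  rw [hsplit]
  refine (norm_add_le _ _).trans (add_le_add ?_ ?_)
  · refine (norm_mixedT_apply_le _ _).trans ?_
    gcongr
    · exact projNorm_nonneg _
    · exact norm_lact_apply_le a z
  · refine (norm_mixedT_apply_le _ _).trans ?_
    gcongr
    refine (projNorm_mul_le _ _).trans ?_
    refine (mul_le_of_le_one_right (projNorm_nonneg _) ht.2).trans ?_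
    exact (projNorm_tmul_le _ _).trans
      (mul_le_of_le_one_left (norm_nonneg _) norm_one_continuousMap_le)

variable [CompleteSpace A]

theorem prodMap_mixedT (t : C(X, ℂ) ⊗[ℂ] C(X, ℂ)) (z : ProjTensor A A) :
    prodMap C(X, A) (mixedT X A t z) = fnMul (LinearMap.mul' ℂ C(X, ℂ) t) (prodMap A z) := by
  induction t with
  | zero => ext; simp
  | add s t hs ht => simp only [map_add, add_apply, hs, ht, fnMul_add]
  | tmul f g =>
    refine projTensor_ext_apply (S := (prodMap C(X, A)).comp (mixedT X A (f ⊗ₜ g)))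
      (R := (fnMul (LinearMap.mul' ℂ C(X, ℂ) (f ⊗ₜ g))).comp (prodMap A)) (fun b c => ?_) z
    simp [mixedT_tmul, fnMul_mul_fnMul]

theorem exists_mixedT_errors {ι : Type w} [Preorder ι] [IsDirectedOrder ι] [Nonempty ι]
    {α : ι → ProjTensor A A} (hα : IsApproxDiagonal α) {M : ℝ} (hM : ∀ ν, ‖α ν‖ ≤ M)
    (F : Finset (C(X, ℂ) × A)) {ε : ℝ} (hε : 0 < ε) :
    ∃ t ν, IsUnitDiagonal t ∧ ∀ p ∈ F,
      ‖lact (fnMul p.1 p.2) (mixedT X A t (α ν)) - ract (fnMul p.1 p.2) (mixedT X A t (α ν))‖ < ε ∧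
      ‖prodMap C(X, A) (mixedT X A t (α ν)) * fnMul p.1 p.2 - fnMul p.1 p.2‖ < ε := by
  have hM0 : 0 ≤ M := (norm_nonneg _).trans (hM (Classical.arbitrary ι))
  -- The tolerance depends on `M` alone and not on `ν`, so `t` can be fixed before `ν` is chosen.
  obtain ⟨t, ht, htF⟩ := exists_unitDiagonal F (fun p => p.1)
    (fun p => ε / 2 / (‖p.2‖ * M + 1)) fun p _ => by positivity
  have hev : ∀ p ∈ F, ∀ᶠ ν in atTop, ‖p.1‖ * ‖lact p.2 (α ν) - ract p.2 (α ν)‖ < ε / 2 ∧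
      ‖p.1‖ * ‖prodMap A (α ν) * p.2 - p.2‖ < ε := fun p _ => by
    have h1 := (tendsto_zero_iff_norm_tendsto_zero.1 (hα.comm p.2)).const_mul ‖p.1‖
    have h2 := (tendsto_iff_norm_sub_tendsto_zero.1 (hα.prod p.2)).const_mul ‖p.1‖
    rw [mul_zero] at h1 h2
    exact (h1.eventually_lt_const (half_pos hε)).and (h2.eventually_lt_const hε)
  obtain ⟨ν, hν⟩ := ((Finset.eventually_all F).2 hev).exists
  refine ⟨t, ν, ht, fun p hp => ⟨?_, ?_⟩⟩
  · have h1 := (lt_div_iff₀ (by positivity)).1 (htF p hp)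
    have h2 : projNorm (commTensor C(X, ℂ) p.1 * t) * (‖p.2‖ * ‖α ν‖)
        ≤ projNorm (commTensor C(X, ℂ) p.1 * t) * (‖p.2‖ * M) := by
      gcongr
      · exact projNorm_nonneg _
      · exact hM ν
    have h3 := projNorm_nonneg (commTensor C(X, ℂ) p.1 * t)
    have h4 := norm_lact_sub_ract_mixedT_le (h := p.1) (a := p.2) ht (α ν)
    have h5 := (hν p hp).1
    nlinarith
  · rw [prodMap_mixedT, ht.1, fnMul_mul_fnMul, one_mul, ← map_sub]
    refine lt_of_le_of_lt ?_ (hν p hp).2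
    exact norm_fnMul_apply_le _ _

theorem exists_mixedT_approxDiagonal [T2Space X] {ι : Type w} [Preorder ι] [IsDirectedOrder ι]
    [Nonempty ι] {α : ι → ProjTensor A A} (hα : IsApproxDiagonal α) {M : ℝ}
    (hM : ∀ ν, ‖α ν‖ ≤ M) :
    ∃ (t : Finset (C(X, ℂ) × A) × ℕ → C(X, ℂ) ⊗[ℂ] C(X, ℂ))
      (ν : Finset (C(X, ℂ) × A) × ℕ → ι), (∀ γ, IsUnitDiagonal (t γ)) ∧
      (∀ γ, ‖mixedT X A (t γ) (α (ν γ))‖ ≤ M) ∧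
      IsApproxDiagonal fun γ => mixedT X A (t γ) (α (ν γ)) := by
  choose t ν ht h using fun γ : Finset (C(X, ℂ) × A) × ℕ =>
    exists_mixedT_errors hα hM γ.1 (ε := 1 / ((γ.2 : ℝ) + 1)) (by positivity)
  have hU : ∀ γ, ‖mixedT X A (t γ) (α (ν γ))‖ ≤ M := fun γ =>
    (norm_mixedT_apply_le _ _).trans
      ((mul_le_of_le_one_left (norm_nonneg _) (ht γ).2).trans (hM _))
  refine ⟨t, ν, ht, hU, ?_, ?_⟩
  · intro f
    -- For fixed `γ`, the commutator with `U γ` is linear in `f` with bound `2 * M`, so generators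
    -- suffice. The unit condition below is treated likewise, its extra `+ 1` coming from the
    -- identity operator.
    refine (tendsto_zero_of_dense_span (K := 2 * M)
      (L := fun γ => (lactL C(X, A)).flip (mixedT X A (t γ) (α (ν γ)))
        - (ractL C(X, A)).flip (mixedT X A (t γ) (α (ν γ)))) ?_ ?_
      (mem_closure_span_fnMul f)).congr fun γ => by simp
    · intro γ g
      simp only [sub_apply, ContinuousLinearMap.flip_apply, lactL_apply, ractL_apply]
      have h1 := norm_lact_apply_le g (mixedT X A (t γ) (α (ν γ)))
      have h2 := norm_ract_apply_le g (mixedT X A (t γ) (α (ν γ)))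
      have h3 := mul_le_mul_of_nonneg_left (hU γ) (norm_nonneg g)
      exact (norm_sub_le _ _).trans (by linarith)
    · rintro _ ⟨p, rfl⟩
      simpa using tendsto_zero_iff_norm_tendsto_zero.2 <| tendsto_errors
        (fun (p : C(X, ℂ) × A) (z : ProjTensor C(X, A) C(X, A)) =>
          ‖lact (fnMul p.1 p.2) z - ract (fnMul p.1 p.2) z‖)
        (fun _ _ => norm_nonneg _) (fun γ p hp => (h γ p hp).1) p
  · intro f
    rw [tendsto_iff_norm_sub_tendsto_zero, ← tendsto_zero_iff_norm_tendsto_zero]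
    refine (tendsto_zero_of_dense_span (K := ‖prodMap C(X, A)‖ * M + 1)
      (L := fun γ => ContinuousLinearMap.mul ℂ C(X, A)
        (prodMap C(X, A) (mixedT X A (t γ) (α (ν γ)))) - ContinuousLinearMap.id ℂ _) ?_ ?_
      (mem_closure_span_fnMul f)).congr fun γ => by simp
    · intro γ g
      simp only [sub_apply, ContinuousLinearMap.mul_apply', ContinuousLinearMap.id_apply]
      rw [add_mul, one_mul]
      refine (norm_sub_le _ _).trans (add_le_add ((norm_mul_le _ _).trans ?_) le_rfl)
      gcongr
      exact ((prodMap C(X, A)).le_opNorm _).trans (by gcongr; exact hU γ)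
    · rintro _ ⟨p, rfl⟩
      simpa using tendsto_zero_iff_norm_tendsto_zero.2 <| tendsto_errors
        (fun (p : C(X, ℂ) × A) (z : ProjTensor C(X, A) C(X, A)) =>
          ‖prodMap C(X, A) z * fnMul p.1 p.2 - fnMul p.1 p.2‖)
        (fun _ _ => norm_nonneg _) (fun γ p hp => (h γ p hp).2) p

end MixedT

/-! ### The lower bound for the Grothendieck constant. -/

section GrothendieckConstant

/-- On a one-point space the form `(x, y) ↦ x y` has norm at most `1` and takes the value `1` at
`(1, 1)`. -/
theorem one_le_grothendieckConst : 1 ≤ grothendieckConst.{u} := by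
  refine le_iInf₂ fun k hk => ?_
  let _ : MeasurableSpace PUnit.{u + 1} := borel _
  have : BorelSpace PUnit.{u + 1} := ⟨rfl⟩
  let δ : StrongDual ℂ C(PUnit.{u + 1}, ℂ) := ContinuousMap.evalCLM ℂ PUnit.unit
  let Φ : C(PUnit.{u + 1}, ℂ) →L[ℂ] C(PUnit.{u + 1}, ℂ) →L[ℂ] ℂ :=
    (ContinuousLinearMap.compL ℂ _ _ ℂ δ).comp (ContinuousLinearMap.mul ℂ C(PUnit.{u + 1}, ℂ))
  have hΦ : ‖Φ‖ ≤ 1 := ContinuousLinearMap.opNorm_le_bound₂ _ zero_le_one fun x y => by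
    change ‖x PUnit.unit * y PUnit.unit‖ ≤ 1 * ‖x‖ * ‖y‖
    rw [norm_mul, one_mul]
    gcongr <;> exact ContinuousMap.norm_coe_le_norm _ _
  obtain ⟨μ₁, μ₂, _, _, _, _, h⟩ := hk PUnit.{u + 1} PUnit.{u + 1} Φ
  have h1 := h 1 1
  have hΦ1 : Φ 1 1 = 1 := by
    change (1 : C(PUnit.{u + 1}, ℂ)) PUnit.unit * (1 : C(PUnit.{u + 1}, ℂ)) PUnit.unit = 1
    simp
  simp only [hΦ1, ContinuousMap.one_apply, norm_one, one_pow, MeasureTheory.integral_const,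
    MeasureTheory.probReal_univ, smul_eq_mul, mul_one, Real.sqrt_one] at h1
  have h2 : (1 : ℝ) ≤ k := h1.trans (mul_le_of_le_one_right k.coe_nonneg hΦ)
  exact_mod_cast h2

/-- The factors `2` cancel in `[0, ∞]` even if the constant were infinite, so its finiteness is not
required. -/
theorem ofReal_le_grothendieckConst_mul {r M : ℝ} (h : r ≤ M) :
    ENNReal.ofReal r ≤ 2 * (grothendieckConst.{u} / 2) * ENNReal.ofReal M := by
  rw [ENNReal.mul_div_cancel (by simp) (by simp)]
  exact (ENNReal.ofReal_le_ofReal h).trans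
    (le_mul_of_one_le_left zero_le one_le_grothendieckConst)

end GrothendieckConstant

/-! ### Passing between `A` and `C(X, A)`. -/

section Evaluation

variable {X : Type u} [TopologicalSpace X] [CompactSpace X]
  {A : Type v} [NonUnitalNormedRing A] [NormedSpace ℂ A] [IsScalarTower ℂ A A]
  [SMulCommClass ℂ A A] [CompleteSpace A]

/-- Bounded approximate diagonals pass to images under bounded surjective homomorphisms. -/
theorem HasBoundedApproxDiagonal.of_surjective {B : Type w} [NonUnitalNormedRing B]
    [NormedSpace ℂ B] [IsScalarTower ℂ B B] [SMulCommClass ℂ B B] [CompleteSpace B]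
    (hA : HasBoundedApproxDiagonal A) (θ : A →L[ℂ] B) (hmul : ∀ a b, θ (a * b) = θ a * θ b)
    (hθ : Function.Surjective θ) : HasBoundedApproxDiagonal B := by
  obtain ⟨ι, _, _, _, d, hd, C, hC⟩ := hA
  have hd' : IsApproxDiagonal fun i => pmap θ θ (d i) := by
    constructor
    · intro b
      obtain ⟨a, rfl⟩ := hθ b
      have h := ((pmap θ θ).continuous.tendsto 0).comp (hd.comm a)
      rw [map_zero] at h
      refine h.congr fun i => ?_
      have hl := projTensor_ext_apply (S := (pmap θ θ).comp (lact a))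
        (R := (lact (θ a)).comp (pmap θ θ)) (fun _ _ => by simp [hmul]) (d i)
      have hr := projTensor_ext_apply (S := (pmap θ θ).comp (ract a))
        (R := (ract (θ a)).comp (pmap θ θ)) (fun _ _ => by simp [hmul]) (d i)
      simp only [ContinuousLinearMap.comp_apply] at hl hr
      rw [Function.comp_apply, map_sub, hl, hr]
    · intro b
      obtain ⟨a, rfl⟩ := hθ b
      refine ((θ.continuous.tendsto a).comp (hd.prod a)).congr fun i => ?_
      have hp := projTensor_ext_apply (S := (prodMap B).comp (pmap θ θ))
        (R := θ.comp (prodMap A)) (fun _ _ => by simp [hmul]) (d i)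
      simp only [ContinuousLinearMap.comp_apply] at hp
      rw [Function.comp_apply, hmul, hp]
  -- The image net is indexed in the universe of `A`; the criterion reindexes it in that of `B`.
  refine hasBoundedApproxDiagonal_iff.2 ⟨‖pmap θ θ‖ * C, fun F ε hε => ?_⟩
  obtain ⟨i, hi⟩ := hd'.exists_errors F hε
  exact ⟨_, ((pmap θ θ).le_opNorm _).trans (by gcongr; exact hC i), hi⟩

theorem HasBoundedApproxDiagonal.of_continuousMap [Nonempty X]
    (h : HasBoundedApproxDiagonal C(X, A)) : HasBoundedApproxDiagonal A :=
  h.of_surjective (ContinuousMap.evalCLM ℂ (Classical.arbitrary X)) (fun _ _ => rfl)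
    fun a => ⟨ContinuousMap.const X a, rfl⟩

theorem HasBoundedApproxDiagonal.continuousMap [T2Space X] (h : HasBoundedApproxDiagonal A) :
    HasBoundedApproxDiagonal C(X, A) := by
  obtain ⟨ι, _, _, _, d, hd, C, hC⟩ := h
  obtain ⟨t, ν, -, hU, hd'⟩ := exists_mixedT_approxDiagonal (X := X) hd hC
  exact ⟨_, inferInstance, inferInstance, inferInstance, _, hd', C, hU⟩

end Evaluation

end

end BanachAmenability

theorem theorem2p1 {X : Type u} [TopologicalSpace X] [CompactSpace X] [T2Space X]
    {A : Type v} [NonUnitalNormedRing A] [NormedSpace ℂ A] [IsScalarTower ℂ A A]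
    [SMulCommClass ℂ A A] [CompleteSpace A] :
    -- a bounded approximate diagonal of `A` yields one of `C(X, A)`, built from `T`,
    -- of norm at most `2 c M` with `c = K_G / 2`
    (∀ (ι : Type w) [Preorder ι] [IsDirectedOrder ι] [Nonempty ι]
      (α : ι → ProjTensor A A) (M : ℝ≥0), IsApproxDiagonal α → (∀ ν, ‖α ν‖ ≤ M) →
      ∃ (κ : Type (max u v)) (_ : Preorder κ) (_ : IsDirectedOrder κ) (_ : Nonempty κ)
        (U : κ → ProjTensor C(X, A) C(X, A)),
        IsApproxDiagonal U ∧
        (∃ C : ℝ, ∀ γ, ‖U γ‖ ≤ C) ∧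
        ∀ γ, ENNReal.ofReal ‖U γ‖ ≤ 2 * (grothendieckConst.{u} / 2) * (M : ℝ≥0∞) ∧
          ∃ (t : C(X, ℂ) ⊗[ℂ] C(X, ℂ)) (ν : ι), U γ = mixedT X A t (α ν) ∧
            LinearMap.mul' ℂ C(X, ℂ) t = 1 ∧
            ENNReal.ofReal (projNorm t) ≤ 2 * (grothendieckConst.{u} / 2)) ∧
    (HasBoundedApproxDiagonal A → HasBoundedApproxDiagonal C(X, A)) ∧
    (Amenable A → Amenable C(X, A)) ∧
    -- the converse
    (Nonempty X →
      (HasBoundedApproxDiagonal C(X, A) ↔ HasBoundedApproxDiagonal A) ∧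
      (Amenable C(X, A) ↔ Amenable A)) := by
  refine ⟨?_, HasBoundedApproxDiagonal.continuousMap, ?_, fun _ => ⟨⟨?_, ?_⟩, ?_⟩⟩
  · intro ι _ _ _ α M hα hM
    obtain ⟨t, ν, ht, hU, hd⟩ := exists_mixedT_approxDiagonal (X := X) hα hM
    refine ⟨Finset (C(X, ℂ) × A) × ℕ, inferInstance, inferInstance, inferInstance, _, hd,
      ⟨M, hU⟩, fun γ => ⟨?_, t γ, ν γ, rfl, (ht γ).1, ?_⟩⟩
    · simpa using ofReal_le_grothendieckConst_mul (hU γ)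
    · simpa using ofReal_le_grothendieckConst_mul (ht γ).2
  · simpa only [amenable_iff_hasBoundedApproxDiagonal]
      using HasBoundedApproxDiagonal.continuousMap
  · exact HasBoundedApproxDiagonal.of_continuousMap
  · exact HasBoundedApproxDiagonal.continuousMap
  · simp only [amenable_iff_hasBoundedApproxDiagonal]
    exact ⟨HasBoundedApproxDiagonal.of_continuousMap, HasBoundedApproxDiagonal.continuousMap⟩
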